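/- Let $q^{1/2}$ be a formal variable, let $\mathcal{T}=\mathbb{Z}[q^{\pm 1/2}]\langle X_1^{\pm 1},X_2^{\pm 1}\mid X_1X_2=qX_2X_1\rangle$ be the quantum torus and $\mathcal{F}$ its skew field of fractions. Define $X_k\in\mathcal{F}$ for all $k\in\mathbb{Z}$ from $X_1,X_2$ by $$X_{k-1}X_{k+1}=\begin{cases} q^{1/2}X_k+1, & k \text{ odd},\\ q^{2}X_k^{4}+1, & k\text{ even},\end{cases}$$ and let $\mathcal{A}_q(1,4)\subseteq\mathcal{F}$ be the $\mathbb{Z}[q^{\pm1/2}]$-subalgebra generated by all $X_k$. For $a,b\in\mathbb{Z}$ put $X^{(a,b)}=q^{-ab/2}X_1^aX_2^b$ and let $$X_\delta=X^{(-1,-2)}+X^{(-1,2)}+X^{(1,-2)}+(q^{-1/2}+q^{1/2})X^{(0,-2)}.$$ Let $F_n,S_n\in\mathbb{Z}[x]$ be given by $F_0=1$, $F_1=x$, $F_2=x^2-2$, $F_{n+1}=F_nx-F_{n-1}$ for $n\ge2$, and $S_0=1$, $S_1=x$, $S_2=x^2-1$, $S_{n+1}=S_nx-S_{n-1}$ for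 $n\ge2$. With $\mathcal{M}=\{q^{-ab/2}X_m^aX_{m+1}^b \mid m\in\mathbb{Z},\ a,b\in\mathbb{Z}_{\ge0}\}$, define the sets $$\mathcal{B}=\mathcal{M}\cup\{F_n(X_\delta)\mid n\ge0\},\quad \mathcal{S}=\mathcal{M}\cup\{S_n(X_\delta)\mid n\ge0\},\quad \mathcal{D}=\mathcal{M}\cup\{X_\delta^n\mid n\ge0\}$$ (these are $\mathbb{Z}[q^{\pm1/2}]$-bases of $\mathcal{A}_q(1,4)$ by an earlier result, which is not part of the present claim). Corollary. Every element $Y$ of $\mathcal{B}$, $\mathcal{S}$ and $\mathcal{D}$ is a positive element of $\mathcal{A}_q(1,4)$. That is, $Y\in\mathcal{A}_q(1,4)$, and for every $m\in\mathbb{Z}$ the element $Y$ has a Laurent expansion $$Y=\sum_{(a,b)\in\mathbb{Z}^2}c_{a,b}\,q^{-ab/2}X_m^aX_{m+1}^b$$ with finitely many non-zero $c_{a,b}\in\mathbb{Z}[q^{\pm1/2}]$, and in every such expansion all coefficients $c_{a,b}$ lie in $\mathbb{N}[q^{\pm1/2}]$. -/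

import Mathlib

open LaurentPolynomial
open scoped nonZeroDivisors

namespace QCluster14

/-- The coefficient ring `ℤ[q^{±1/2}]`: Laurent polynomials over `ℤ` in the variable `q^{1/2}`,
so that `q^{r/2}` is `T r`. -/
abbrev Coeff : Type := LaurentPolynomial ℤ

/-! ### The quantum torus -/

/-- The quantum torus `ℤ[q^{±1/2}]⟨X₁^{±1}, X₂^{±1} | X₁ X₂ = q X₂ X₁⟩`, as the free
`ℤ[q^{±1/2}]`-module on the normalized monomials `X^{(a,b)} = q^{-ab/2} X₁^a X₂^b`. -/
def QTorus : Type := (ℤ × ℤ) →₀ Coeff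

namespace QTorus

noncomputable instance : AddCommGroup QTorus := inferInstanceAs (AddCommGroup ((ℤ × ℤ) →₀ Coeff))

noncomputable instance : Module Coeff QTorus := inferInstanceAs (Module Coeff ((ℤ × ℤ) →₀ Coeff))

/-- The finitely supported family of coefficients of the monomials `X^{(a,b)}`. -/
noncomputable def toFinsupp : QTorus ≃ₗ[Coeff] ((ℤ × ℤ) →₀ Coeff) :=
  LinearEquiv.refl Coeff ((ℤ × ℤ) →₀ Coeff)

/-- The element `c X^{(a,b)}` for `x = (a,b)`. -/
noncomputable def single (x : ℤ × ℤ) (c : Coeff) : QTorus := toFinsupp.symm (Finsupp.single x c)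

/-- The exponent of `q^{1/2}` in
`X^{(a,b)} X^{(c,d)} = q^{-(bc-ad)/2} X^{(a+c,b+d)}`. -/
def twist (x y : ℤ × ℤ) : ℤ := -(x.2 * y.1 - x.1 * y.2)

noncomputable instance : Mul QTorus where
  mul f g := (toFinsupp f).sum fun x r =>
    (toFinsupp g).sum fun y s => single (x + y) (r * s * T (twist x y))

noncomputable instance : One QTorus where
  one := single 0 1

lemma mul_def (f g : QTorus) : f * g = (toFinsupp f).sum fun x r =>
    (toFinsupp g).sum fun y s => single (x + y) (r * s * T (twist x y)) := rfl

lemma one_def : (1 : QTorus) = single 0 1 := rfl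

@[simp]
lemma single_zero (x : ℤ × ℤ) : single x 0 = 0 := by simp [single]

lemma single_add (x : ℤ × ℤ) (r s : Coeff) : single x (r + s) = single x r + single x s := by
  simp [single]

lemma smul_single (c : Coeff) (x : ℤ × ℤ) (r : Coeff) : c • single x r = single x (c * r) := by
  simp [single, ← map_smul]

lemma induction_linear {p : QTorus → Prop} (f : QTorus) (h0 : p 0)
    (hadd : ∀ f g, p f → p g → p (f + g)) (hs : ∀ x r, p (single x r)) : p f :=
  Finsupp.induction_linear (motive := fun f => p (toFinsupp.symm f)) (toFinsupp f) h0
    (fun _ _ h₁ h₂ => hadd _ _ h₁ h₂) hs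

protected lemma zero_mul (f : QTorus) : 0 * f = 0 := by simp [mul_def]

protected lemma mul_zero (f : QTorus) : f * 0 = 0 := by simp [mul_def]

protected lemma add_mul (f g h : QTorus) : (f + g) * h = f * h + g * h := by
  simp only [mul_def, map_add]
  refine Finsupp.sum_add_index' (fun x => ?_) (fun x r s => ?_)
  · simp
  · rw [← Finsupp.sum_add]
    simp [single_add, add_mul]

protected lemma mul_add (f g h : QTorus) : f * (g + h) = f * g + f * h := by
  simp only [mul_def, map_add]
  rw [← Finsupp.sum_add]
  refine Finset.sum_congr rfl fun x _ => ?_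
  refine Finsupp.sum_add_index' (fun y => ?_) (fun y r s => ?_)
  · simp
  · simp [single_add, mul_add, add_mul]

lemma single_mul_single (x y : ℤ × ℤ) (r s : Coeff) :
    single x r * single y s = single (x + y) (r * s * T (twist x y)) := by
  simp only [mul_def]
  simp only [single, LinearEquiv.apply_symm_apply]
  rw [Finsupp.sum_single_index, Finsupp.sum_single_index] <;> simp

protected lemma mul_assoc (f g h : QTorus) : f * g * h = f * (g * h) := by
  induction f using induction_linear with
  | h0 => simp only [QTorus.zero_mul]
  | hadd f f' hf hf' => simp only [QTorus.add_mul, hf, hf']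
  | hs x r =>
  induction g using induction_linear with
  | h0 => simp only [QTorus.zero_mul, QTorus.mul_zero]
  | hadd f f' hf hf' => simp only [QTorus.add_mul, QTorus.mul_add, hf, hf']
  | hs y s =>
  induction h using induction_linear with
  | h0 => simp only [QTorus.mul_zero]
  | hadd f f' hf hf' => simp only [QTorus.mul_add, hf, hf']
  | hs z t =>
  simp only [single_mul_single, add_assoc]
  congr 1
  have h1 : (T (twist x y) * T (twist (x + y) z) : Coeff) = T (twist y z) * T (twist x (y + z)) := by
    rw [← T_add, ← T_add]
    congr 1
    simp [twist]
    ring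
  linear_combination r * s * t * h1

protected lemma one_mul (f : QTorus) : 1 * f = f := by
  induction f using induction_linear with
  | h0 => exact QTorus.mul_zero _
  | hadd f f' hf hf' => simp only [QTorus.mul_add, hf, hf']
  | hs x r => simp [one_def, single_mul_single, twist]

protected lemma mul_one (f : QTorus) : f * 1 = f := by
  induction f using induction_linear with
  | h0 => exact QTorus.zero_mul _
  | hadd f f' hf hf' => simp only [QTorus.add_mul, hf, hf']
  | hs x r => simp [one_def, single_mul_single, twist]

noncomputable instance : Ring QTorus where
  __ := (inferInstance : AddCommGroup QTorus)
  left_distrib := QTorus.mul_add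
  right_distrib := QTorus.add_mul
  zero_mul := QTorus.zero_mul
  mul_zero := QTorus.mul_zero
  mul_assoc := QTorus.mul_assoc
  one_mul := QTorus.one_mul
  mul_one := QTorus.mul_one

protected lemma smul_mul (c : Coeff) (f g : QTorus) : c • f * g = c • (f * g) := by
  induction f using induction_linear with
  | h0 => simp
  | hadd f f' hf hf' => simp only [smul_add, add_mul, hf, hf']
  | hs x r =>
  induction g using induction_linear with
  | h0 => simp
  | hadd f f' hf hf' => simp only [smul_add, mul_add, hf, hf']
  | hs y s =>
  simp only [single_mul_single, smul_single, mul_assoc]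

protected lemma mul_smul (c : Coeff) (f g : QTorus) : f * c • g = c • (f * g) := by
  induction f using induction_linear with
  | h0 => simp
  | hadd f f' hf hf' => simp only [smul_add, add_mul, hf, hf']
  | hs x r =>
  induction g using induction_linear with
  | h0 => simp
  | hadd f f' hf hf' => simp only [smul_add, mul_add, hf, hf']
  | hs y s =>
  simp only [single_mul_single, smul_single, mul_assoc, mul_left_comm]

noncomputable instance : Algebra Coeff QTorus :=
  Algebra.ofModule QTorus.smul_mul QTorus.mul_smul

instance : Nontrivial QTorus := inferInstanceAs (Nontrivial ((ℤ × ℤ) →₀ Coeff))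

/-! The skew field of fractions exists because the quantum torus is an Ore domain. -/

/-- The coefficient of `X^{(a,b)}`. -/
noncomputable def coeff (z : ℤ × ℤ) : QTorus →ₗ[Coeff] Coeff :=
  Finsupp.lapply z ∘ₗ toFinsupp.toLinearMap

/-- The finite set of exponents that occur. -/
noncomputable def supp (f : QTorus) : Finset (ℤ × ℤ) := (toFinsupp f).support

lemma mem_supp {f : QTorus} {z : ℤ × ℤ} : z ∈ supp f ↔ coeff z f ≠ 0 := Finsupp.mem_support_iff

lemma ext_coeff {f g : QTorus} (h : ∀ z, coeff z f = coeff z g) : f = g :=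
  toFinsupp.injective (Finsupp.ext h)

lemma coeff_single (z x : ℤ × ℤ) (r : Coeff) : coeff z (single x r) = if x = z then r else 0 := by
  simp [coeff, single, Finsupp.single_apply]

lemma coeff_mul (f g : QTorus) (z : ℤ × ℤ) :
    coeff z (f * g) = ∑ x ∈ supp f, ∑ y ∈ supp g,
      if x + y = z then coeff x f * coeff y g * T (twist x y) else 0 := by
  rw [mul_def, Finsupp.sum, map_sum]
  refine Finset.sum_congr rfl fun x _ => ?_
  rw [Finsupp.sum, map_sum]
  refine Finset.sum_congr rfl fun y _ => ?_
  rw [coeff_single]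
  rfl

lemma coeff_mul_of_uniqueAdd (f g : QTorus) (x y : ℤ × ℤ)
    (hx : x ∈ supp f) (hy : y ∈ supp g)
    (h : UniqueAdd (supp f) (supp g) x y) :
    coeff (x + y) (f * g) = coeff x f * coeff y g * T (twist x y) := by
  rw [coeff_mul, Finset.sum_eq_single x, Finset.sum_eq_single y]
  · simp
  · intro y' hy' hne
    rw [if_neg]
    intro he
    exact hne (h hx hy' he).2
  · exact fun h => absurd hy h
  · intro x' hx' hne
    refine Finset.sum_eq_zero fun y' hy' => ?_
    rw [if_neg]
    intro he
    exact hne (h hx' hy' he).1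
  · exact fun h => absurd hx h

instance : NoZeroDivisors QTorus where
  eq_zero_or_eq_zero_of_mul_eq_zero {f g} hfg := by
    by_contra! hne
    have hf : (supp f).Nonempty := Finsupp.support_nonempty_iff.2 (by simpa using hne.1)
    have hg : (supp g).Nonempty := Finsupp.support_nonempty_iff.2 (by simpa using hne.2)
    obtain ⟨x, hx, y, hy, h⟩ := UniqueSums.uniqueAdd_of_nonempty hf hg
    have h1 := coeff_mul_of_uniqueAdd f g x y hx hy h
    rw [hfg, map_zero] at h1
    have hT : (T (twist x y) : Coeff) ≠ 0 := (isUnit_T _).ne_zero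
    have h2 : coeff x f ≠ 0 := mem_supp.1 hx
    have h3 : coeff y g ≠ 0 := mem_supp.1 hy
    exact mul_ne_zero (mul_ne_zero h2 h3) hT h1.symm

/-- The box `[-N, N]²` of exponents. -/
noncomputable def box (N : ℤ) : Finset (ℤ × ℤ) := Finset.Icc (-N) N ×ˢ Finset.Icc (-N) N

lemma mem_box {N : ℤ} {x : ℤ × ℤ} : x ∈ box N ↔ (-N ≤ x.1 ∧ x.1 ≤ N) ∧ -N ≤ x.2 ∧ x.2 ≤ N := by
  simp [box]

lemma exists_box (f : QTorus) : ∃ k : ℕ, supp f ⊆ box k := by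
  refine ⟨(supp f).sup fun x => x.1.natAbs + x.2.natAbs, fun x hx => ?_⟩
  have h := Finset.le_sup (f := fun x : ℤ × ℤ => x.1.natAbs + x.2.natAbs) hx
  rw [mem_box]
  change x.1.natAbs + x.2.natAbs ≤ _ at h
  omega

lemma coeff_mul_eq_zero {f g : QTorus} {M N : ℕ} (hf : supp f ⊆ box M)
    (hg : supp g ⊆ box N) {z : ℤ × ℤ} (hz : z ∉ box (M + N)) :
    coeff z (f * g) = 0 := by
  rw [coeff_mul]
  refine Finset.sum_eq_zero fun x hx => Finset.sum_eq_zero fun y hy => ?_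
  rw [if_neg]
  rintro rfl
  have h1 := mem_box.1 (hf hx)
  have h2 := mem_box.1 (hg hy)
  apply hz
  rw [mem_box]
  simp only [Prod.fst_add, Prod.snd_add]
  omega

/-- The Laurent polynomial with coefficients `c` supported in the box `[-N, N]²`. -/
noncomputable def ofBox (N : ℕ) : (box N → Coeff) →ₗ[Coeff] QTorus where
  toFun c := ∑ i : box N, single i (c i)
  map_add' c d := by simp [single_add, Finset.sum_add_distrib]
  map_smul' c d := by simp [Finset.smul_sum, smul_single]

lemma coeff_ofBox (N : ℕ) (c : box N → Coeff) (i : box N) : coeff i (ofBox N c) = c i := by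
  simp [ofBox, map_sum, coeff_single]

lemma support_ofBox (N : ℕ) (c : box N → Coeff) : supp (ofBox N c) ⊆ box N := by
  intro z hz
  by_contra hn
  apply mem_supp.1 hz
  change coeff z (∑ i : box N, single i (c i)) = 0
  simp only [map_sum, coeff_single]
  refine Finset.sum_eq_zero fun i _ => if_neg ?_
  rintro rfl
  exact hn i.2

lemma ofBox_injective (N : ℕ) : Function.Injective (ofBox N) := by
  intro c d h
  funext i
  have := congrArg (coeff i) h
  rwa [coeff_ofBox, coeff_ofBox] at this

lemma card_box (N : ℕ) : Fintype.card (box N) = (2 * N + 1) ^ 2 := by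
  rw [Fintype.card_coe, box, Finset.card_product, Int.card_Icc, sq]
  congr 1 <;> omega

/-- The left Ore condition. -/
lemma exists_common_multiple (f g : QTorus) (hg : g ≠ 0) :
    ∃ u w : QTorus, u ≠ 0 ∧ u * f = w * g := by
  obtain ⟨k₁, h₁⟩ := exists_box f
  obtain ⟨k₂, h₂⟩ := exists_box g
  obtain ⟨k, hk₁, hk₂⟩ : ∃ k : ℕ, supp f ⊆ box k ∧ supp g ⊆ box k := by
    refine ⟨k₁ + k₂, fun x hx => ?_, fun x hx => ?_⟩
    · have := mem_box.1 (h₁ hx); rw [mem_box]; push_cast; omega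
    · have := mem_box.1 (h₂ hx); rw [mem_box]; push_cast; omega
  set N := 3 * k + 1 with hN
  let L : (box N ⊕ box N → Coeff) →ₗ[Coeff] (box ((N + k : ℕ) : ℤ) → Coeff) :=
    LinearMap.pi fun z => coeff z ∘ₗ
      ((LinearMap.mulRight Coeff f) ∘ₗ ofBox N ∘ₗ LinearMap.funLeft Coeff Coeff Sum.inl -
       (LinearMap.mulRight Coeff g) ∘ₗ ofBox N ∘ₗ LinearMap.funLeft Coeff Coeff Sum.inr)
  have hL : ¬ Function.Injective L := by
    intro h
    have := card_le_of_injective Coeff L h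
    rw [Fintype.card_sum, card_box, card_box] at this
    rw [hN] at this
    nlinarith
  rw [← LinearMap.ker_eq_bot, LinearMap.ker_eq_bot'] at hL
  push Not at hL
  obtain ⟨c, hc, hne⟩ := hL
  set u := ofBox N (fun i => c (Sum.inl i)) with hu
  set w := ofBox N (fun i => c (Sum.inr i)) with hw
  have huw : u * f = w * g := by
    refine ext_coeff fun z => ?_
    by_cases hz : z ∈ box ((N + k : ℕ) : ℤ)
    · have := congrFun hc ⟨z, hz⟩
      rw [← sub_eq_zero, ← map_sub]
      exact this
    · push_cast at hz
      rw [coeff_mul_eq_zero (support_ofBox _ _) hk₁ hz, coeff_mul_eq_zero (support_ofBox _ _) hk₂ hz]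
  refine ⟨u, w, fun h0 => hne ?_, huw⟩
  have hw0 : w = 0 := by
    rw [h0, zero_mul] at huw
    exact (mul_eq_zero.1 huw.symm).resolve_right hg
  have e1 := ofBox_injective N (h0.trans (map_zero (ofBox N)).symm)
  have e2 := ofBox_injective N (hw0.trans (map_zero (ofBox N)).symm)
  funext i
  cases i with
  | inl i => exact congrFun e1 i
  | inr i => exact congrFun e2 i

lemma nonempty_oreSet : Nonempty (OreLocalization.OreSet QTorus⁰) := by
  rw [OreLocalization.nonempty_oreSet_iff_of_noZeroDivisors]
  intro r s
  obtain ⟨u, w, hu, h⟩ := exists_common_multiple r s (nonZeroDivisors.coe_ne_zero s)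
  exact ⟨w, ⟨u, mem_nonZeroDivisors_of_ne_zero hu⟩, h⟩

noncomputable instance : OreLocalization.OreSet QTorus⁰ := nonempty_oreSet.some

end QTorus

/-! ### The skew field of fractions, cluster variables and the quantum cluster algebra -/

/-- The skew field of fractions `ℱ` of the quantum torus. -/
abbrev SkewField : Type := OreLocalization QTorus⁰ QTorus

/-- The inclusion of the quantum torus into its skew field of fractions. -/
noncomputable def incl : QTorus →+* SkewField := OreLocalization.numeratorRingHom

/-- The initial cluster variable `X₁`. -/
noncomputable def X₁ : SkewField := incl (QTorus.single (1, 0) 1)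

/-- The initial cluster variable `X₂`. -/
noncomputable def X₂ : SkewField := incl (QTorus.single (0, 1) 1)

/-- The right-hand side of the exchange relation `X_{k-1} X_{k+1} = exchange k X_k`:
`q^{1/2} X_k + 1` for odd `k` and `q^2 X_k^4 + 1` for even `k`. -/
noncomputable def exchange (k : ℤ) (x : SkewField) : SkewField :=
  if Odd k then (T 1 : Coeff) • x + 1 else (T 4 : Coeff) • x ^ 4 + 1

/-- `forward n = X_{n+1}`, from `X_{k+1} = X_{k-1}⁻¹ (X_{k-1} X_{k+1})`. -/
noncomputable def forward : ℕ → SkewField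
  | 0 => X₁
  | 1 => X₂
  | (n + 2) => (forward n)⁻¹ * exchange (n + 2) (forward (n + 1))

/-- `backward n = X_{2-n}`, from `X_{k-1} = (X_{k-1} X_{k+1}) X_{k+1}⁻¹`. -/
noncomputable def backward : ℕ → SkewField
  | 0 => X₂
  | 1 => X₁
  | (n + 2) => exchange (1 - n) (backward (n + 1)) * (backward n)⁻¹

/-- The cluster variables `X_k`, `k ∈ ℤ`. They are determined by `X₁`, `X₂` and the exchange
relations, see `clusterVar_exchange`. -/
noncomputable def clusterVar (k : ℤ) : SkewField :=
  if 1 ≤ k then forward (k - 1).toNat else backward (2 - k).toNat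

/-! The recursion never divides by zero, so that the exchange relations hold. -/

lemma incl_injective : Function.Injective incl :=
  OreLocalization.numeratorHom_inj inf_le_left

lemma smul_one_injective : Function.Injective fun r : Coeff => r • (1 : SkewField) := by
  intro r s h
  simp only [← Algebra.algebraMap_eq_smul_one] at h
  have h1 : (algebraMap Coeff QTorus r) = algebraMap Coeff QTorus s := incl_injective h
  rw [Algebra.algebraMap_eq_smul_one, Algebra.algebraMap_eq_smul_one, QTorus.one_def,
    QTorus.smul_single, QTorus.smul_single] at h1
  simpa [QTorus.coeff_single] using congrArg (QTorus.coeff 0) h1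

lemma X₁_ne_zero : X₁ ≠ 0 := by
  rw [X₁, Ne, map_eq_zero_iff _ incl_injective]
  intro h
  simpa [QTorus.coeff_single] using congrArg (QTorus.coeff (1, 0)) h

lemma X₂_ne_zero : X₂ ≠ 0 := by
  rw [X₂, Ne, map_eq_zero_iff _ incl_injective]
  intro h
  simpa [QTorus.coeff_single] using congrArg (QTorus.coeff (0, 1)) h

lemma incl_smul (r : Coeff) (f : QTorus) : incl (r • f) = r • incl f := by
  rw [Algebra.smul_def, Algebra.smul_def, map_mul]
  rfl

/-- `a b = q b a` for non-zero elements `a` and `b` of the skew field. -/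
def QCommute (a b : SkewField) : Prop := a ≠ 0 ∧ b ≠ 0 ∧ a * b = (T 2 : Coeff) • (b * a)

lemma qCommute_X₁_X₂ : QCommute X₁ X₂ := by
  refine ⟨X₁_ne_zero, X₂_ne_zero, ?_⟩
  rw [X₁, X₂, ← map_mul, ← map_mul, ← incl_smul, QTorus.single_mul_single,
    QTorus.single_mul_single, QTorus.smul_single]
  congr 2
  rw [one_mul, one_mul, one_mul, ← T_add]
  congr 1

lemma pow_ne_scalar_left {a b : SkewField} (h : QCommute a b) (r : Coeff) {j : ℕ} (hj : j ≠ 0) :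
    r • a ^ j + 1 ≠ 0 := by
  intro h0
  have hpow : ∀ i : ℕ, a ^ i * b = (T (2 * i) : Coeff) • (b * a ^ i) := by
    intro i
    induction i with
    | zero => simp
    | succ i ih =>
      rw [pow_succ', mul_assoc, ih, mul_smul_comm, ← mul_assoc, h.2.2, smul_mul_assoc, smul_smul,
        ← T_add, mul_assoc]
      congr 2
  have hr : r • a ^ j = -1 := eq_neg_of_add_eq_zero_left h0
  have h1 : r • (a ^ j * b) = -b := by rw [← smul_mul_assoc, hr, neg_one_mul]
  have h2 : r • (b * a ^ j) = -b := by rw [← mul_smul_comm, hr, mul_neg_one]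
  rw [hpow, smul_comm, h2, smul_neg, neg_inj] at h1
  have h3 : (T (2 * j) : Coeff) • (1 : SkewField) = (1 : Coeff) • (1 : SkewField) := by
    have := congrArg (· * b⁻¹) h1
    simpa [smul_mul_assoc, mul_inv_cancel₀ h.2.1] using this
  have h4 : (T (2 * j) : Coeff) = T 0 := by
    rw [T_zero]
    exact smul_one_injective h3
  have h5 := congrArg (fun r : Coeff => r.coeff 0) h4
  simp only [T, AddMonoidAlgebra.coeff_single, Finsupp.single_apply] at h5
  rw [if_neg (by omega), if_pos trivial] at h5
  exact zero_ne_one h5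

lemma pow_ne_scalar_right {a b : SkewField} (h : QCommute a b) (r : Coeff) {j : ℕ} (hj : j ≠ 0) :
    r • b ^ j + 1 ≠ 0 := by
  refine pow_ne_scalar_left (a := b) (b := a⁻¹) ⟨h.2.1, inv_ne_zero h.1, ?_⟩ r hj
  have := congrArg (fun x => a⁻¹ * x * a⁻¹) h.2.2
  simpa [mul_assoc, inv_mul_cancel_left₀ h.1, mul_inv_cancel₀ h.1, mul_smul_comm, smul_mul_assoc]
    using this

lemma exchange_ne_zero_left {a b : SkewField} (h : QCommute a b) (k : ℤ) : exchange k a ≠ 0 := by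
  rw [exchange]
  split_ifs
  · simpa using pow_ne_scalar_left h (T 1) one_ne_zero
  · exact pow_ne_scalar_left h (T 4) four_ne_zero

lemma exchange_ne_zero_right {a b : SkewField} (h : QCommute a b) (k : ℤ) : exchange k b ≠ 0 := by
  rw [exchange]
  split_ifs
  · simpa using pow_ne_scalar_right h (T 1) one_ne_zero
  · exact pow_ne_scalar_right h (T 4) four_ne_zero

lemma exchange_comm (k : ℤ) (x : SkewField) : x * exchange k x = exchange k x * x := by
  rw [exchange]
  split_ifs
  · simp [mul_add, add_mul]
  · simp [mul_add, add_mul, ← pow_succ, ← pow_succ']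

lemma QCommute.next {a b : SkewField} (h : QCommute a b) (k : ℤ) :
    QCommute b (a⁻¹ * exchange k b) := by
  have h1 : b * a⁻¹ = (T 2 : Coeff) • (a⁻¹ * b) := by
    have := congrArg (fun x => a⁻¹ * x * a⁻¹) h.2.2
    simpa [mul_assoc, inv_mul_cancel_left₀ h.1, mul_inv_cancel₀ h.1, mul_smul_comm,
      smul_mul_assoc] using this
  refine ⟨h.2.1, mul_ne_zero (inv_ne_zero h.1) (exchange_ne_zero_right h k), ?_⟩
  rw [← mul_assoc, h1, smul_mul_assoc, mul_assoc, exchange_comm, mul_assoc]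

lemma QCommute.prev {a b : SkewField} (h : QCommute a b) (k : ℤ) :
    QCommute (exchange k a * b⁻¹) a := by
  have h1 : b⁻¹ * a = (T 2 : Coeff) • (a * b⁻¹) := by
    have := congrArg (fun x => b⁻¹ * x * b⁻¹) h.2.2
    simpa [mul_assoc, inv_mul_cancel_left₀ h.2.1, mul_inv_cancel₀ h.2.1, mul_smul_comm,
      smul_mul_assoc] using this
  refine ⟨mul_ne_zero (exchange_ne_zero_left h k) (inv_ne_zero h.2.1), h.1, ?_⟩
  rw [mul_assoc, h1, mul_smul_comm, ← mul_assoc, ← exchange_comm, mul_assoc]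

lemma qCommute_forward (n : ℕ) : QCommute (forward n) (forward (n + 1)) := by
  induction n with
  | zero => exact qCommute_X₁_X₂
  | succ n ih => exact ih.next _

lemma qCommute_backward (n : ℕ) : QCommute (backward (n + 1)) (backward n) := by
  induction n with
  | zero => exact qCommute_X₁_X₂
  | succ n ih => exact ih.prev _

lemma clusterVar_one : clusterVar 1 = X₁ := rfl

lemma clusterVar_two : clusterVar 2 = X₂ := rfl

lemma clusterVar_forward (n : ℕ) : clusterVar (n + 1) = forward n := by
  rw [clusterVar, if_pos (by omega)]
  congr 1
  omega

lemma clusterVar_backward (n : ℕ) : clusterVar (2 - n) = backward n := by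
  rcases n with _ | _ | n
  · rfl
  · rfl
  · rw [clusterVar, if_neg (by push_cast; omega)]
    congr 1
    push_cast
    omega

/-- The exchange relations. -/
theorem clusterVar_exchange (k : ℤ) :
    clusterVar (k - 1) * clusterVar (k + 1) = exchange k (clusterVar k) := by
  rcases le_or_gt 2 k with hk | hk
  · obtain ⟨n, rfl⟩ : ∃ n : ℕ, k = n + 2 := ⟨(k - 2).toNat, by omega⟩
    rw [show (n + 2 - 1 : ℤ) = n + 1 by ring,
      show (n + 2 + 1 : ℤ) = (n + 2 : ℕ) + 1 by push_cast; ring,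
      show (n + 2 : ℤ) = (n + 1 : ℕ) + 1 by push_cast; ring, clusterVar_forward,
      clusterVar_forward, clusterVar_forward, forward, mul_inv_cancel_left₀ (qCommute_forward n).1]
    congr 1
  · obtain ⟨n, rfl⟩ : ∃ n : ℕ, k = 1 - n := ⟨(1 - k).toNat, by omega⟩
    rw [show (1 - n - 1 : ℤ) = 2 - (n + 2 : ℕ) by push_cast; ring,
      show (1 - n + 1 : ℤ) = 2 - n by ring, clusterVar_backward, clusterVar_backward,
      show clusterVar (1 - n) = backward (n + 1) by
        rw [← clusterVar_backward]; congr 1; push_cast; ring,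
      backward, inv_mul_cancel_right₀ (qCommute_backward n).2.1]

/-- The quantum cluster algebra `𝒜_q(1,4)`. -/
noncomputable def quantumClusterAlgebra : Subalgebra Coeff SkewField :=
  Algebra.adjoin Coeff (Set.range clusterVar)

/-- The normalized Laurent monomial `q^{-ab/2} X_m^a X_{m+1}^b` in the cluster `{X_m, X_{m+1}}`. -/
noncomputable def laurentMonomial (m a b : ℤ) : SkewField :=
  (T (-(a * b)) : Coeff) • (clusterVar m ^ a * clusterVar (m + 1) ^ b)

/-- The element
`X_δ = X^{(-1,-2)} + X^{(-1,2)} + X^{(1,-2)} + (q^{-1/2} + q^{1/2}) X^{(0,-2)}`. -/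
noncomputable def Xδ : SkewField :=
  laurentMonomial 1 (-1) (-2) + laurentMonomial 1 (-1) 2 + laurentMonomial 1 1 (-2) +
    (T (-1) + T 1 : Coeff) • laurentMonomial 1 0 (-2)

/-! ### The bases -/

/-- The Chebyshev polynomials `F₀ = 1`, `F₁ = x`, `F₂ = x² - 2`,
`F_{n+1} = F_n x - F_{n-1}` for `n ≥ 2`. -/
noncomputable def chebyshevF : ℕ → Polynomial ℤ
  | 0 => 1
  | 1 => Polynomial.X
  | 2 => Polynomial.X ^ 2 - 2
  | (n + 3) => chebyshevF (n + 2) * Polynomial.X - chebyshevF (n + 1)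

/-- The Chebyshev polynomials `S₀ = 1`, `S₁ = x`, `S₂ = x² - 1`,
`S_{n+1} = S_n x - S_{n-1}` for `n ≥ 2`. -/
noncomputable def chebyshevS : ℕ → Polynomial ℤ
  | 0 => 1
  | 1 => Polynomial.X
  | 2 => Polynomial.X ^ 2 - 1
  | (n + 3) => chebyshevS (n + 2) * Polynomial.X - chebyshevS (n + 1)

/-- The value of an integral polynomial at an element of the skew field. -/
noncomputable def evalAt (x : SkewField) (p : Polynomial ℤ) : SkewField :=
  p.eval₂ (Int.castRingHom SkewField) x

/-- The cluster monomials `q^{-ab/2} X_m^a X_{m+1}^b`, `m ∈ ℤ`, `a, b ≥ 0`. -/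
def clusterMonomials : Set SkewField :=
  {Y | ∃ (m : ℤ) (a b : ℕ), Y = laurentMonomial m a b}

/-- The basis `ℬ`. -/
def basisB : Set SkewField :=
  clusterMonomials ∪ Set.range fun n : ℕ => evalAt Xδ (chebyshevF n)

/-- The basis `𝒮`. -/
def basisS : Set SkewField :=
  clusterMonomials ∪ Set.range fun n : ℕ => evalAt Xδ (chebyshevS n)

/-- The basis `𝒟`. -/
def basisD : Set SkewField :=
  clusterMonomials ∪ Set.range fun n : ℕ => Xδ ^ n

/-! ### Positivity -/

/-- `c` is a Laurent expansion of `Y` in the cluster `{X_m, X_{m+1}}`: only finitely many of the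
coefficients `c (a, b) ∈ ℤ[q^{±1/2}]` are non-zero and
`Y = ∑ c (a, b) q^{-ab/2} X_m^a X_{m+1}^b`. -/
def IsLaurentExpansion (m : ℤ) (Y : SkewField) (c : (ℤ × ℤ) →₀ Coeff) : Prop :=
  Y = c.sum fun x r => r • laurentMonomial m x.1 x.2

/-- Membership in `ℕ[q^{±1/2}] ⊆ ℤ[q^{±1/2}]`. -/
def IsNatCoeff (r : Coeff) : Prop := ∀ k : ℤ, 0 ≤ r.coeff k

/-- `Y ∈ 𝒜_q(1,4)` is positive: in every cluster `{X_m, X_{m+1}}` it has a Laurent expansion, and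
the coefficients of its Laurent expansion lie in `ℕ[q^{±1/2}]`. -/
def IsPositive (Y : SkewField) : Prop :=
  Y ∈ quantumClusterAlgebra ∧
    ∀ m : ℤ, (∃ c, IsLaurentExpansion m Y c) ∧
      ∀ c, IsLaurentExpansion m Y c → ∀ x, IsNatCoeff (c x)

end QCluster14

/-!
The whole argument takes place in a division ring with a sequence `x : ℤ → D` that satisfies the
relations of the cluster variables (`IsClusterSeq`). Translating the sequence by an even number, or
reflecting it while reversing the multiplication, gives such a sequence again, and some of these
operations move any given cluster `{X_m, X_{m+1}}` to the indices `{1, 2}`. So it is enough to know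
that the elements in question lie in the semiring `IsQPair.cone` of Laurent polynomials in `x 1`,
`x 2` with coefficients in `ℕ[q^{±1/2}]`. Uniqueness of Laurent expansions is linear independence of
the monomials, which are simultaneous eigenvectors of conjugation by monomials with different
eigenvalues (`IsQPair.coeff_eq_zero_of_sum_eq_zero`).

The element `δ = X_δ` satisfies `δ X_{2n} = q^{1/2} X_{2n-2} + q^{-1/2} X_{2n+2}` for all `n`
(`deltaLaurent_mul`), which also shows that it has the same Laurent polynomial in all clusters, and
`δ = q^{1/2} X₀ X₄ - q^{3/2} X₂²` lies in the quantum cluster algebra. The elements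
`u_n = q^{-n/2} X_{2n}` then satisfy `u_{n+1} = δ u_n - u_{n-1}`. Write `δ = B + C + E` where
`B = X^{(-1,2)}` and `C = X^{(1,-2)}` are inverse to each other. The differences
`v_n = u_{n+1} - B u_n` satisfy `v_{n+1} = (C + E) v_n + E B u_n`, which contains no subtraction, so
all `u_n` are positive; exchanging `B` and `C` takes care of negative `n`
(`mem_of_linear_recurrence`).

The same recurrences show that `u_n` and `u_{n+1}` dominate monomials which are inverse to each
other up to a power of `q`; hence `X_{2n} X_{2n+2} - 1 = q^{1/2} X_{2n+1}` is positive (`mem_cone`).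
Finally `F_n(δ) u_k = u_{k-n} + u_{k+n}`, so that `F_n(δ)` is a positive element divided by the
monomial `u₁`, and `S_{n+2} = S_n + F_{n+2}` gives the positivity of `S_n(δ)`.
-/

namespace QCluster14

section

variable {D : Type*} [DivisionRing D] [Algebra Coeff D]

/-! ### Monomials in two `q`-commuting elements -/

/-- Two non-zero elements with `x y = q y x`. -/
structure IsQPair (x y : D) : Prop where
  left_ne_zero : x ≠ 0
  right_ne_zero : y ≠ 0
  mul_eq : x * y = (T 2 : Coeff) • (y * x)

/-- The normalized monomial `q^{-ab/2} x^a y^b`. -/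
noncomputable def torusMonomial (x y : D) (a b : ℤ) : D := (T (-(a * b)) : Coeff) • (x ^ a * y ^ b)

lemma T_smul_T_smul {M : Type*} [AddCommGroup M] [Module Coeff M] (a b : ℤ) (m : M) :
    (T a : Coeff) • (T b : Coeff) • m = (T (a + b) : Coeff) • m := by
  rw [smul_smul, ← T_add]

lemma T_zero_smul {M : Type*} [AddCommGroup M] [Module Coeff M] (m : M) :
    (T 0 : Coeff) • m = m := by rw [T_zero, one_smul]

lemma T_injective : Function.Injective (T : ℤ → Coeff) := by
  intro a b h
  have h1 := congrArg (fun r : Coeff => r.coeff b) h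
  simp only [T, AddMonoidAlgebra.coeff_single, Finsupp.single_apply, if_true] at h1
  by_contra hab
  rw [if_neg hab] at h1
  exact zero_ne_one h1

namespace IsQPair

variable {x y : D}

lemma zpow_mul (h : IsQPair x y) (a : ℤ) : x ^ a * y = (T (2 * a) : Coeff) • (y * x ^ a) := by
  have hinv : x⁻¹ * y = (T (-2) : Coeff) • (y * x⁻¹) := by
    apply mul_left_cancel₀ h.left_ne_zero
    rw [mul_inv_cancel_left₀ h.left_ne_zero, mul_smul_comm, ← mul_assoc, h.mul_eq, smul_mul_assoc,
      T_smul_T_smul, mul_inv_cancel_right₀ h.left_ne_zero, show (-2 + 2 : ℤ) = 0 by rfl,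
      T_zero_smul]
  induction a using Int.induction_on with
  | zero => simp
  | succ i ih =>
    rw [zpow_add_one₀ h.left_ne_zero, mul_assoc, h.mul_eq, mul_smul_comm, ← mul_assoc, ih,
      smul_mul_assoc, T_smul_T_smul, mul_assoc, show (2 + 2 * (i : ℤ)) = 2 * (i + 1) by ring]
  | pred i ih =>
    rw [zpow_sub_one₀ h.left_ne_zero, mul_assoc, hinv, mul_smul_comm, ← mul_assoc, ih,
      smul_mul_assoc, T_smul_T_smul, mul_assoc, show (-2 + 2 * (-i : ℤ)) = 2 * (-i - 1) by ring]

lemma zpow_mul_zpow (h : IsQPair x y) (a b : ℤ) :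
    x ^ a * y ^ b = (T (2 * (a * b)) : Coeff) • (y ^ b * x ^ a) := by
  have hy := h.right_ne_zero
  have hinv : x ^ a * y⁻¹ = (T (-(2 * a)) : Coeff) • (y⁻¹ * x ^ a) := by
    apply mul_right_cancel₀ hy
    rw [inv_mul_cancel_right₀ hy, smul_mul_assoc, mul_assoc, h.zpow_mul, mul_smul_comm,
      T_smul_T_smul, inv_mul_cancel_left₀ hy, neg_add_cancel, T_zero_smul]
  induction b using Int.induction_on with
  | zero => simp
  | succ i ih =>
    rw [zpow_add_one₀ hy, ← mul_assoc, ih, smul_mul_assoc, mul_assoc, h.zpow_mul, mul_smul_comm,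
      T_smul_T_smul, ← mul_assoc (y ^ (i : ℤ)),
      show 2 * (a * i) + 2 * a = 2 * (a * (i + 1)) by ring]
  | pred i ih =>
    rw [zpow_sub_one₀ hy, ← mul_assoc, ih, smul_mul_assoc, mul_assoc, hinv, mul_smul_comm,
      T_smul_T_smul, ← mul_assoc (y ^ (-i : ℤ)),
      show 2 * (a * -i) + -(2 * a) = 2 * (a * (-i - 1)) by ring]

lemma torusMonomial_mul (h : IsQPair x y) (a b c d : ℤ) :
    torusMonomial x y a b * torusMonomial x y c d =
      (T (a * d - b * c) : Coeff) • torusMonomial x y (a + c) (b + d) := by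
  have h1 : y ^ b * x ^ c = (T (-(2 * (c * b))) : Coeff) • (x ^ c * y ^ b) := by
    rw [h.zpow_mul_zpow, T_smul_T_smul, neg_add_cancel, T_zero_smul]
  simp only [torusMonomial]
  rw [smul_mul_assoc, mul_smul_comm, mul_assoc, ← mul_assoc (y ^ b), h1, smul_mul_assoc,
    mul_smul_comm, mul_assoc, ← zpow_add₀ h.right_ne_zero,
    ← mul_assoc (x ^ a), ← zpow_add₀ h.left_ne_zero]
  simp only [T_smul_T_smul]
  congr 2
  ring

lemma torusMonomial_zero_zero : torusMonomial x y 0 0 = 1 := by simp [torusMonomial]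

lemma torusMonomial_one_zero : torusMonomial x y 1 0 = x := by simp [torusMonomial]

lemma torusMonomial_zero_one : torusMonomial x y 0 1 = y := by simp [torusMonomial]

lemma torusMonomial_mul_right (h : IsQPair x y) (a b : ℤ) :
    torusMonomial x y a b * y = (T a : Coeff) • torusMonomial x y a (b + 1) := by
  simpa [torusMonomial_zero_one] using h.torusMonomial_mul a b 0 1

lemma left_mul_torusMonomial (h : IsQPair x y) (a b : ℤ) :
    x * torusMonomial x y a b = (T b : Coeff) • torusMonomial x y (1 + a) b := by
  simpa [torusMonomial_one_zero] using h.torusMonomial_mul 1 0 a b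

lemma right_mul_torusMonomial (h : IsQPair x y) (a b : ℤ) :
    y * torusMonomial x y a b = (T (-a) : Coeff) • torusMonomial x y a (1 + b) := by
  simpa [torusMonomial_zero_one] using h.torusMonomial_mul 0 1 a b

lemma torusMonomial_pow (h : IsQPair x y) (a b : ℤ) (n : ℕ) :
    torusMonomial x y a b ^ n = torusMonomial x y (n * a) (n * b) := by
  induction n with
  | zero => simp [torusMonomial]
  | succ n ih =>
    rw [pow_succ, ih, h.torusMonomial_mul, show n * a * b - n * b * a = 0 by ring, T_zero_smul]
    push_cast
    congr 1 <;> ring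

lemma torusMonomial_ne_zero (h : IsQPair x y) (a b : ℤ) : torusMonomial x y a b ≠ 0 := by
  intro h0
  have h1 := h.torusMonomial_mul a b (-a) (-b)
  rw [h0, zero_mul, show a * -b - b * -a = 0 by ring, T_zero_smul, add_neg_cancel, add_neg_cancel,
    torusMonomial_zero_zero] at h1
  exact zero_ne_one h1

/-- The normalized monomials are linearly independent: left and right multiplication by a monomial
differ, on each of them, by a power of `q`, and different monomials are told apart by these
powers. -/
lemma coeff_eq_zero_of_sum_eq_zero (h : IsQPair x y)
    (hD : Function.Injective fun r : Coeff => r • (1 : D)) (s : Finset (ℤ × ℤ))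
    (c : ℤ × ℤ → Coeff) (hc : ∑ z ∈ s, c z • torusMonomial x y z.1 z.2 = 0) :
    ∀ z ∈ s, c z = 0 := by
  have hsmul : ∀ (r : Coeff) (z : ℤ × ℤ), r • torusMonomial x y z.1 z.2 = 0 → r = 0 := by
    intro r z h0
    rw [← one_mul (torusMonomial x y z.1 z.2), ← smul_mul_assoc] at h0
    have h1 := (mul_eq_zero.1 h0).resolve_right (h.torusMonomial_ne_zero _ _)
    exact hD (by simpa using h1)
  induction s using Finset.induction_on generalizing c with
  | empty => simp
  | insert z₀ s hz₀ ih =>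
    -- Conjugating the relation by a monomial `w` and eliminating the term at `z₀`.
    have key : ∀ w : ℤ × ℤ, ∀ z ∈ s, (T (2 * (w.1 * z.2 - w.2 * z.1)) -
        T (2 * (w.1 * z₀.2 - w.2 * z₀.1))) * c z = 0 := by
      intro w
      refine ih _ ?_
      have h1 : ∑ z ∈ insert z₀ s, (T (2 * (w.1 * z.2 - w.2 * z.1)) * c z) •
          torusMonomial x y z.1 z.2 = 0 := by
        apply mul_right_cancel₀ (h.torusMonomial_ne_zero w.1 w.2)
        rw [zero_mul, ← mul_zero (torusMonomial x y w.1 w.2), ← hc, Finset.sum_mul,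
          Finset.mul_sum]
        refine Finset.sum_congr rfl fun z _ => ?_
        rw [mul_smul_comm, h.torusMonomial_mul, smul_mul_assoc, h.torusMonomial_mul, mul_comm,
          mul_smul, T_smul_T_smul, add_comm z.1, add_comm z.2]
        congr 3
        ring
      have h2 : ∑ z ∈ insert z₀ s, (T (2 * (w.1 * z₀.2 - w.2 * z₀.1)) * c z) •
          torusMonomial x y z.1 z.2 = 0 := by
        simp only [mul_smul, ← Finset.smul_sum, hc, smul_zero]
      have h3 := sub_eq_zero.2 (h1.trans h2.symm)
      rw [← Finset.sum_sub_distrib, Finset.sum_insert hz₀, sub_self, zero_add] at h3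
      simpa only [← sub_smul, ← sub_mul] using h3
    have hs : ∀ z ∈ s, c z = 0 := by
      intro z hz
      have hT : ∀ {a b : ℤ}, (T a - T b) * c z = 0 → a ≠ b → c z = 0 := by
        intro a b h0 hab
        refine (mul_eq_zero.1 h0).resolve_left fun h1 => hab ?_
        exact T_injective (sub_eq_zero.1 h1)
      by_contra hcz
      have h1 : z.1 = z₀.1 := by
        by_contra hne
        exact hcz (hT (key (0, 1) z hz) (by simpa using hne))
      have h2 : z.2 = z₀.2 := by
        by_contra hne
        exact hcz (hT (key (1, 0) z hz) (by simpa using hne))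
      exact hz₀ (Prod.ext h1 h2 ▸ hz)
    rw [Finset.sum_insert hz₀, Finset.sum_eq_zero (fun z hz => by rw [hs z hz, zero_smul]),
      add_zero] at hc
    intro z hz
    rcases Finset.mem_insert.1 hz with rfl | hz
    · exact hsmul _ _ hc
    · exact hs z hz

end IsQPair

/-! ### Cluster sequences -/

/-- A sequence in a division ring that satisfies the relations between the cluster variables of
`𝒜_q(1,4)`. -/
structure IsClusterSeq (x : ℤ → D) : Prop where
  ne_zero : ∀ k, x k ≠ 0
  mul_succ : ∀ k, x k * x (k + 1) = (T 2 : Coeff) • (x (k + 1) * x k)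
  exchange_odd : ∀ k, Odd k → x (k - 1) * x (k + 1) = (T 1 : Coeff) • x k + 1
  exchange_even : ∀ k, Even k → x (k - 1) * x (k + 1) = (T 4 : Coeff) • x k ^ 4 + 1

/-- The Laurent polynomial that defines `X_δ`, in the variables `a` and `b`. -/
noncomputable def deltaLaurent (a b : D) : D :=
  torusMonomial a b (-1) (-2) + torusMonomial a b (-1) 2 + torusMonomial a b 1 (-2) +
    (T (-1) + T 1 : Coeff) • torusMonomial a b 0 (-2)

namespace IsClusterSeq

variable {x : ℤ → D}

lemma isQPair (h : IsClusterSeq x) (k : ℤ) : IsQPair (x k) (x (k + 1)) :=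
  ⟨h.ne_zero k, h.ne_zero (k + 1), h.mul_succ k⟩

lemma pred_mul (h : IsClusterSeq x) (k : ℤ) :
    x (k - 1) * x k = (T 2 : Coeff) • (x k * x (k - 1)) := by
  simpa using h.mul_succ (k - 1)

lemma pred_mul_pow (h : IsClusterSeq x) (k : ℤ) (n : ℕ) :
    x (k - 1) * x k ^ n = (T (2 * n) : Coeff) • (x k ^ n * x (k - 1)) := by
  induction n with
  | zero => simp
  | succ n ih =>
    rw [pow_succ, ← mul_assoc, ih, smul_mul_assoc, mul_assoc, h.pred_mul, mul_smul_comm,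
      T_smul_T_smul, ← mul_assoc]
    rfl

lemma rev_exchange_odd (h : IsClusterSeq x) {k : ℤ} (hk : Odd k) :
    x (k + 1) * x (k - 1) = (T (-1) : Coeff) • x k + 1 := by
  apply mul_left_cancel₀ (h.ne_zero (k - 1))
  rw [← mul_assoc, h.exchange_odd k hk, add_mul, mul_add, mul_smul_comm, h.pred_mul,
    T_smul_T_smul, smul_mul_assoc, one_mul, mul_one]
  rfl

lemma rev_exchange_even (h : IsClusterSeq x) {k : ℤ} (hk : Even k) :
    x (k + 1) * x (k - 1) = (T (-4) : Coeff) • x k ^ 4 + 1 := by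
  apply mul_left_cancel₀ (h.ne_zero (k - 1))
  rw [← mul_assoc, h.exchange_even k hk, add_mul, mul_add, mul_smul_comm, h.pred_mul_pow,
    T_smul_T_smul, smul_mul_assoc, one_mul, mul_one]
  rfl

/-- Translating by an even number gives a sequence with the same relations. -/
lemma shift (h : IsClusterSeq x) (j : ℤ) : IsClusterSeq fun k => x (2 * j + k) where
  ne_zero k := h.ne_zero _
  mul_succ k := by simpa only [add_assoc] using h.mul_succ (2 * j + k)
  exchange_odd k hk := by
    have := h.exchange_odd (2 * j + k) (by grind)
    simpa only [add_assoc, add_sub_assoc] using this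
  exchange_even k hk := by
    have := h.exchange_even (2 * j + k) (by grind)
    simpa only [add_assoc, add_sub_assoc] using this

open MulOpposite in
/-- Reversing both the order of the sequence and the order of the factors preserves the
relations. -/
lemma reflect (h : IsClusterSeq x) (j : ℤ) : IsClusterSeq fun k => op (x (2 * j - k)) where
  ne_zero k := by simpa using h.ne_zero _
  mul_succ k := by
    have := h.mul_succ (2 * j - (k + 1))
    rw [show 2 * j - (k + 1) + 1 = 2 * j - k by ring] at this
    rw [← op_mul, ← op_mul, ← op_smul, this]
  exchange_odd k hk := by
    have := h.exchange_odd (2 * j - k) (by grind)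
    rw [show 2 * j - k + 1 = 2 * j - (k - 1) by ring,
      show 2 * j - k - 1 = 2 * j - (k + 1) by ring] at this
    rw [← op_mul, ← op_smul, this, op_add, op_one]
  exchange_even k hk := by
    have := h.exchange_even (2 * j - k) (by grind)
    rw [show 2 * j - k + 1 = 2 * j - (k - 1) by ring,
      show 2 * j - k - 1 = 2 * j - (k + 1) by ring] at this
    rw [← op_mul, ← op_pow, ← op_smul, this, op_add, op_one]

/-! ### The recurrence of the even cluster variables -/

/-- A product of two cluster variables at distance three; the factor `X_{k-1} X_{k+1}` arises after
multiplying by `X_k`. -/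
lemma mul_of_even_left (h : IsClusterSeq x) {k : ℤ} (hk : Even k) :
    x (k - 2) * x (k + 1) = (T 3 : Coeff) • x k ^ 3 + (T (-1) : Coeff) • x (k + 2) := by
  have h1 := h.rev_exchange_odd (k := k - 1) (by grind)
  have h2 := h.exchange_odd (k := k + 1) (by grind)
  have h3 := h.exchange_even k hk
  rw [sub_add_cancel, show k - 1 - 1 = k - 2 by ring] at h1
  rw [add_sub_cancel_right, show k + 1 + 1 = k + 2 by ring] at h2
  apply mul_left_cancel₀ (h.ne_zero k)
  rw [← mul_assoc, h1, add_mul, smul_mul_assoc, h3, mul_add, mul_smul_comm, mul_smul_comm, h2,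
    ← pow_succ']
  simp only [smul_add, T_smul_T_smul]
  norm_num
  abel

lemma mul_of_even_right (h : IsClusterSeq x) {k : ℤ} (hk : Even k) :
    x (k + 2) * x (k - 1) = (T (-3) : Coeff) • x k ^ 3 + (T 1 : Coeff) • x (k - 2) := by
  have h1 := h.exchange_odd (k := k + 1) (by grind)
  have h2 := h.rev_exchange_odd (k := k - 1) (by grind)
  have h3 := h.rev_exchange_even hk
  rw [add_sub_cancel_right, show k + 1 + 1 = k + 2 by ring] at h1
  rw [sub_add_cancel, show k - 1 - 1 = k - 2 by ring] at h2
  apply mul_left_cancel₀ (h.ne_zero k)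
  rw [← mul_assoc, h1, add_mul, smul_mul_assoc, h3, mul_add, mul_smul_comm, mul_smul_comm, h2,
    ← pow_succ']
  simp only [smul_add, T_smul_T_smul]
  norm_num
  abel

/-- The element `d` with `d X_k = q^{1/2} X_{k-2} + q^{-1/2} X_{k+2}`, for even `k`. -/
noncomputable def ratio (x : ℤ → D) (k : ℤ) : D :=
  ((T 1 : Coeff) • x (k - 2) + (T (-1) : Coeff) • x (k + 2)) * (x k)⁻¹

lemma ratio_mul_self (h : IsClusterSeq x) (k : ℤ) :
    ratio x k * x k = (T 1 : Coeff) • x (k - 2) + (T (-1) : Coeff) • x (k + 2) :=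
  inv_mul_cancel_right₀ (h.ne_zero k) _

lemma ratio_mul_succ (h : IsClusterSeq x) {k : ℤ} (hk : Even k) :
    ratio x k * x (k + 1) = (T 2 : Coeff) • x k ^ 2 + (T (-2) : Coeff) • x (k + 2) ^ 2 := by
  have h1 := h.rev_exchange_odd (k := k + 1) (by grind)
  rw [add_sub_cancel_right, show k + 1 + 1 = k + 2 by ring] at h1
  have h2 : x (k + 1) * x k = (T (-2) : Coeff) • (x k * x (k + 1)) := by
    rw [h.mul_succ, T_smul_T_smul, neg_add_cancel, T_zero_smul]
  apply mul_right_cancel₀ (h.ne_zero k)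
  rw [mul_assoc, h2, mul_smul_comm, ← mul_assoc, h.ratio_mul_self, add_mul, add_mul,
    smul_mul_assoc, h.mul_of_even_left hk, smul_mul_assoc, smul_mul_assoc, smul_mul_assoc,
    sq (x (k + 2)), mul_assoc (x (k + 2)), h1, ← pow_succ, mul_add, mul_smul_comm, mul_one]
  simp only [smul_add, T_smul_T_smul]
  norm_num
  abel

lemma ratio_mul_pred (h : IsClusterSeq x) {k : ℤ} (hk : Even k) :
    ratio x k * x (k - 1) = (T 2 : Coeff) • x (k - 2) ^ 2 + (T (-2) : Coeff) • x k ^ 2 := by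
  have h1 := h.exchange_odd (k := k - 1) (by grind)
  rw [sub_add_cancel, show k - 1 - 1 = k - 2 by ring] at h1
  apply mul_right_cancel₀ (h.ne_zero k)
  rw [mul_assoc, h.pred_mul, mul_smul_comm, ← mul_assoc, h.ratio_mul_self, add_mul, add_mul,
    smul_mul_assoc, smul_mul_assoc, h.mul_of_even_right hk, smul_mul_assoc, smul_mul_assoc,
    sq (x (k - 2)), mul_assoc (x (k - 2)) _ (x k), h1, ← pow_succ, mul_add, mul_smul_comm, mul_one]
  simp only [smul_add, T_smul_T_smul]
  norm_num
  abel

/-- Consecutive ratios agree, because both times the odd cluster variable in between equal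
`q X_k² + q⁻¹ X_{k+2}²`. -/
lemma ratio_eq (h : IsClusterSeq x) (n : ℤ) : ratio x (2 * n) = ratio x 2 := by
  have hstep : ∀ k : ℤ, Even k → ratio x (k + 2) = ratio x k := by
    intro k hk
    apply mul_right_cancel₀ (h.ne_zero (k + 1))
    have := h.ratio_mul_pred (k := k + 2) (by grind)
    rw [show k + 2 - 1 = k + 1 by ring, add_sub_cancel_right] at this
    rw [this, h.ratio_mul_succ hk]
  have h0 : ∀ n : ℤ, ratio x (2 * n) = ratio x 0 := by
    intro n
    induction n using Int.induction_on with
    | zero => simp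
    | succ i ih => rw [mul_add, mul_one, hstep _ (by simp), ih]
    | pred i ih => rw [← ih, ← hstep _ (by simp)]; congr 1; ring
  rw [h0, ← h0 1, mul_one]

lemma isQPair_one_two (h : IsClusterSeq x) : IsQPair (x 1) (x 2) := h.isQPair 1

lemma zero_eq (h : IsClusterSeq x) :
    x 0 = torusMonomial (x 1) (x 2) 1 (-1) + torusMonomial (x 1) (x 2) 0 (-1) := by
  apply mul_right_cancel₀ (h.ne_zero 2)
  have h1 : x 0 * x 2 = _ := h.exchange_odd 1 odd_one
  rw [h1, add_mul, h.isQPair_one_two.torusMonomial_mul_right,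
    h.isQPair_one_two.torusMonomial_mul_right, neg_add_cancel, T_zero_smul,
    IsQPair.torusMonomial_zero_zero, IsQPair.torusMonomial_one_zero]

lemma three_eq (h : IsClusterSeq x) :
    x 3 = torusMonomial (x 1) (x 2) (-1) 4 + torusMonomial (x 1) (x 2) (-1) 0 := by
  apply mul_left_cancel₀ (h.ne_zero 1)
  have h1 : x 1 * x 3 = _ := h.exchange_even 2 even_two
  rw [h1, mul_add, h.isQPair_one_two.left_mul_torusMonomial,
    h.isQPair_one_two.left_mul_torusMonomial, add_neg_cancel, T_zero_smul,
    IsQPair.torusMonomial_zero_zero]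
  simp only [torusMonomial, zero_mul, neg_zero, T_zero_smul, zpow_zero, one_mul]
  norm_cast

lemma four_eq (h : IsClusterSeq x) :
    x 4 = torusMonomial (x 1) (x 2) (-1) 3 + torusMonomial (x 1) (x 2) (-1) (-1) +
      torusMonomial (x 1) (x 2) 0 (-1) := by
  apply mul_left_cancel₀ (h.ne_zero 2)
  have h1 : x 2 * x 4 = _ := h.exchange_odd 3 (by decide)
  rw [h1, h.three_eq, mul_add, mul_add, h.isQPair_one_two.right_mul_torusMonomial,
    h.isQPair_one_two.right_mul_torusMonomial, h.isQPair_one_two.right_mul_torusMonomial, smul_add]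
  norm_num [T_zero_smul, IsQPair.torusMonomial_zero_zero]

lemma deltaLaurent_mul (h : IsClusterSeq x) (n : ℤ) :
    deltaLaurent (x 1) (x 2) * x (2 * n) =
      (T 1 : Coeff) • x (2 * n - 2) + (T (-1) : Coeff) • x (2 * n + 2) := by
  have h1 : deltaLaurent (x 1) (x 2) = ratio x 2 := by
    apply mul_right_cancel₀ (h.ne_zero 2)
    rw [h.ratio_mul_self]
    norm_num only
    rw [h.zero_eq, h.four_eq, deltaLaurent]
    simp only [add_mul, smul_mul_assoc, h.isQPair_one_two.torusMonomial_mul_right, smul_add,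
      T_smul_T_smul, add_smul]
    norm_num
    abel
  rw [h1, ← h.ratio_eq n, h.ratio_mul_self]

/-- The element `deltaLaurent` does not depend on the cluster, up to translation by `2`. -/
lemma deltaLaurent_shift (h : IsClusterSeq x) (j : ℤ) :
    deltaLaurent (x (2 * j + 1)) (x (2 * j + 2)) = deltaLaurent (x 1) (x 2) := by
  apply mul_right_cancel₀ (h.ne_zero (2 * (j + 1)))
  rw [h.deltaLaurent_mul]
  have := (h.shift j).deltaLaurent_mul 1
  convert this using 2 <;> ring_nf

/-- The mirror image of `deltaLaurent_mul`. -/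
lemma mul_deltaLaurent (h : IsClusterSeq x) (n : ℤ) :
    x (2 * n) * deltaLaurent (x 1) (x 2) =
      (T (-1) : Coeff) • x (2 * n - 2) + (T 1 : Coeff) • x (2 * n + 2) := by
  apply mul_right_cancel₀ (h.ne_zero (2 * n))
  have h1 := h.exchange_odd (2 * n + 1) (by grind)
  have h2 := h.rev_exchange_odd (k := 2 * n + 1) (by grind)
  have h3 := h.exchange_odd (2 * n - 1) (by grind)
  have h4 := h.rev_exchange_odd (k := 2 * n - 1) (by grind)
  rw [add_sub_cancel_right, show 2 * n + 1 + 1 = 2 * n + 2 by ring] at h1 h2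
  rw [sub_add_cancel, show 2 * n - 1 - 1 = 2 * n - 2 by ring] at h3 h4
  rw [mul_assoc, h.deltaLaurent_mul, mul_add, add_mul]
  simp only [mul_smul_comm, smul_mul_assoc, h1, h2, h3, h4, smul_add, T_smul_T_smul]
  norm_num
  abel

open MulOpposite in
/-- The element `deltaLaurent` does not change under the reflections of the sequence. -/
lemma deltaLaurent_reflect (h : IsClusterSeq x) (j : ℤ) :
    deltaLaurent (op (x (2 * j + 1))) (op (x (2 * j))) = op (deltaLaurent (x 1) (x 2)) := by
  have h1 := (h.reflect (j + 1)).deltaLaurent_mul 1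
  have h2 := congrArg op (h.mul_deltaLaurent j)
  rw [op_mul, op_add, op_smul, op_smul] at h2
  rw [show 2 * (j + 1) - 1 = 2 * j + 1 by ring, show 2 * (j + 1) - 2 = 2 * j by ring,
    show 2 * (j + 1) - 2 * 1 = 2 * j by ring, show 2 * (j + 1) - (2 * 1 - 2) = 2 * j + 2 by ring,
    show 2 * (j + 1) - (2 * 1 + 2) = 2 * j - 2 by ring] at h1
  apply mul_right_cancel₀ (b := op (x (2 * j))) (by simpa using h.ne_zero _)
  rw [h1, h2, add_comm]

/-- The expression of `deltaLaurent` as a polynomial in the cluster variables. -/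
lemma deltaLaurent_eq (h : IsClusterSeq x) :
    deltaLaurent (x 1) (x 2) = (T 1 : Coeff) • (x 0 * x 4) - (T 3 : Coeff) • x 2 ^ 2 := by
  have h1 : _ = (T 1 : Coeff) • x 0 + (T (-1) : Coeff) • x 4 := h.deltaLaurent_mul 1
  have h2 : x 2 * x 4 = (T 1 : Coeff) • x 3 + 1 := h.exchange_odd 3 (by decide)
  have h3 : ratio x 2 * x 3 = (T 2 : Coeff) • x 2 ^ 2 + (T (-2) : Coeff) • x 4 ^ 2 :=
    h.ratio_mul_succ even_two
  have h4 : deltaLaurent (x 1) (x 2) = ratio x 2 := by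
    apply mul_right_cancel₀ (h.ne_zero 2)
    rw [h.ratio_mul_self]
    exact h1
  -- Evaluate `δ x₂ x₄` in two ways.
  have h5 := congrArg (· * x 4) h1
  simp only [mul_one] at h5
  rw [mul_assoc, h2, mul_add, mul_smul_comm, mul_one, add_mul, smul_mul_assoc, smul_mul_assoc,
    h4, h3, ← sq, ← h4] at h5
  simp only [smul_add, T_smul_T_smul] at h5
  norm_num at h5
  rw [eq_sub_iff_add_eq]
  apply add_right_cancel (b := (T (-1) : Coeff) • x 4 ^ 2)
  rw [← h5]
  abel

end IsClusterSeq

/-! ### The positive semiring of a cluster -/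

/-- The monomials `q^{k/2} x^a y^b`. -/
noncomputable def IsQPair.monomials {x y : D} (h : IsQPair x y) : Submonoid D where
  carrier := {Y | ∃ k a b : ℤ, Y = (T k : Coeff) • torusMonomial x y a b}
  one_mem' := ⟨0, 0, 0, by rw [T_zero_smul, IsQPair.torusMonomial_zero_zero]⟩
  mul_mem' := by
    rintro _ _ ⟨k, a, b, rfl⟩ ⟨l, c, d, rfl⟩
    refine ⟨l + k + (a * d - b * c), a + c, b + d, ?_⟩
    rw [smul_mul_assoc, mul_smul_comm, h.torusMonomial_mul, T_smul_T_smul, T_smul_T_smul]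
    congr 2
    ring

/-- The semiring of Laurent polynomials in `x` and `y` with coefficients in `ℕ[q^{±1/2}]`: the sums
of monomials `q^{k/2} x^a y^b`. -/
noncomputable def IsQPair.cone {x y : D} (h : IsQPair x y) : Subsemiring D :=
  h.monomials.subsemiringClosure

namespace IsQPair

variable {x y : D}

lemma cone_induction (h : IsQPair x y) {p : D → Prop} (h0 : p 0)
    (hadd : ∀ f g, p f → p g → p (f + g))
    (hs : ∀ k a b : ℤ, p ((T k : Coeff) • torusMonomial x y a b)) {Y : D} (hY : Y ∈ h.cone) :
    p Y := by
  rw [cone, ← SetLike.mem_coe, Submonoid.subsemiringClosure_coe, SetLike.mem_coe] at hY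
  induction hY using AddSubmonoid.closure_induction with
  | mem Y hY => obtain ⟨k, a, b, rfl⟩ := hY; exact hs k a b
  | zero => exact h0
  | add f g _ _ hf hg => exact hadd f g hf hg

lemma T_smul_torusMonomial_mem (h : IsQPair x y) (k a b : ℤ) :
    (T k : Coeff) • torusMonomial x y a b ∈ h.cone := by
  rw [cone, ← SetLike.mem_coe, Submonoid.subsemiringClosure_coe, SetLike.mem_coe]
  exact AddSubmonoid.subset_closure ⟨k, a, b, rfl⟩

lemma torusMonomial_mem (h : IsQPair x y) (a b : ℤ) : torusMonomial x y a b ∈ h.cone := by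
  simpa only [T_zero_smul] using h.T_smul_torusMonomial_mem 0 a b

lemma T_smul_mem (h : IsQPair x y) (k : ℤ) {Y : D} (hY : Y ∈ h.cone) :
    (T k : Coeff) • Y ∈ h.cone := by
  have h1 := h.T_smul_torusMonomial_mem k 0 0
  rw [torusMonomial_zero_zero] at h1
  simpa only [smul_mul_assoc, one_mul] using h.cone.mul_mem h1 hY

lemma inv_right_mem (h : IsQPair x y) : y⁻¹ ∈ h.cone := by
  simpa [torusMonomial] using h.torusMonomial_mem 0 (-1)

end IsQPair

/-! ### Positivity of subtraction-free linear recurrences -/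

/-- Positivity for the linear recurrence `u_{n+2} = δ u_{n+1} - u_n`. If `δ = B + C + E` with
`C B = 1`, the differences `v_n = u_{n+1} - B u_n` satisfy the subtraction-free recurrence
`v_{n+1} = (C + E) v_n + E B u_n`. -/
lemma mem_of_linear_recurrence {R : Type*} [Ring R] (P : Subsemiring R) {B C E δ : R} {u : ℕ → R}
    (hB : B ∈ P) (hC : C ∈ P) (hE : E ∈ P) (hδ : δ = B + C + E) (hCB : C * B = 1)
    (hu : ∀ n, u (n + 2) = δ * u (n + 1) - u n) (h0 : u 0 ∈ P) (h1 : u 1 - B * u 0 ∈ P) (n : ℕ) :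
    u n ∈ P ∧ u (n + 1) - B * u n ∈ P ∧ u n - B ^ n * u 0 ∈ P ∧
      u (n + 1) - B * u n - C ^ n * (u 1 - B * u 0) ∈ P := by
  induction n with
  | zero => simpa using ⟨h0, h1⟩
  | succ n ih =>
    obtain ⟨i1, i2, i3, i4⟩ := ih
    have hv : u (n + 2) - B * u (n + 1) = (C + E) * (u (n + 1) - B * u n) + E * B * u n := by
      rw [hu, hδ]
      linear_combination (norm := noncomm_ring) hCB * u n
    have hnext : u (n + 1) = B * u n + (u (n + 1) - B * u n) := by abel
    have m1 : u (n + 1) ∈ P := by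
      rw [hnext]
      exact add_mem (mul_mem hB i1) i2
    refine ⟨m1, ?_, ?_, ?_⟩
    · rw [hv]
      exact add_mem (mul_mem (add_mem hC hE) i2) (mul_mem (mul_mem hE hB) i1)
    · have : u (n + 1) - B ^ (n + 1) * u 0 =
          B * (u n - B ^ n * u 0) + (u (n + 1) - B * u n) := by
        rw [pow_succ']; noncomm_ring
      rw [this]
      exact add_mem (mul_mem hB i3) i2
    · have : u (n + 2) - B * u (n + 1) - C ^ (n + 1) * (u 1 - B * u 0) =
          C * (u (n + 1) - B * u n - C ^ n * (u 1 - B * u 0)) + E * (u (n + 1) - B * u n) +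
            E * B * u n := by
        rw [hv, pow_succ']; noncomm_ring
      rw [this]
      exact add_mem (add_mem (mul_mem hC i4) (mul_mem hE i2)) (mul_mem (mul_mem hE hB) i1)

lemma mul_sub_one_mem {R : Type*} [Ring R] (P : Subsemiring R) {a b s t : R} (hs : s ∈ P)
    (hb : b ∈ P) (ha : a - s ∈ P) (ht : b - t ∈ P) (hst : s * t = 1) : a * b - 1 ∈ P := by
  have : a * b - 1 = (a - s) * b + s * (b - t) := by
    rw [← hst]; noncomm_ring
  rw [this]
  exact add_mem (mul_mem ha hb) (mul_mem hs ht)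

/-! ### Positivity in the initial cluster -/

namespace IsClusterSeq

variable {x : ℤ → D}

/-- The elements `q^{-n/2} X_{2n}`, which satisfy a linear recurrence without powers of `q`. -/
noncomputable def evenVar (x : ℤ → D) (n : ℤ) : D := (T (-n) : Coeff) • x (2 * n)

lemma eq_smul_evenVar (x : ℤ → D) (n : ℤ) : x (2 * n) = (T n : Coeff) • evenVar x n := by
  rw [evenVar, T_smul_T_smul, add_neg_cancel, T_zero_smul]

lemma deltaLaurent_mul_evenVar (h : IsClusterSeq x) (n : ℤ) :
    deltaLaurent (x 1) (x 2) * evenVar x n = evenVar x (n - 1) + evenVar x (n + 1) := by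
  rw [evenVar, mul_smul_comm, h.deltaLaurent_mul, smul_add, T_smul_T_smul, T_smul_T_smul, evenVar,
    evenVar]
  ring_nf

/-- The positive semiring of the cluster `{X₁, X₂}`. -/
noncomputable abbrev cone (h : IsClusterSeq x) : Subsemiring D := h.isQPair_one_two.cone

lemma evenVar_one : evenVar x 1 = (T (-1) : Coeff) • torusMonomial (x 1) (x 2) 0 1 := by
  simp [evenVar, IsQPair.torusMonomial_zero_one]

lemma evenVar_zero (h : IsClusterSeq x) :
    evenVar x 0 = torusMonomial (x 1) (x 2) 1 (-1) + torusMonomial (x 1) (x 2) 0 (-1) := by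
  simp only [evenVar, neg_zero, T_zero_smul, mul_zero, h.zero_eq]

lemma evenVar_two (h : IsClusterSeq x) :
    evenVar x 2 = (T (-2) : Coeff) • (torusMonomial (x 1) (x 2) (-1) 3 +
      torusMonomial (x 1) (x 2) (-1) (-1) + torusMonomial (x 1) (x 2) 0 (-1)) := by
  rw [← h.four_eq]
  rfl

/-- The part of `deltaLaurent` other than the two mutually inverse monomials `X^{(-1,2)}` and
`X^{(1,-2)}`. -/
lemma rest_mem (h : IsClusterSeq x) :
    torusMonomial (x 1) (x 2) (-1) (-2) +
      (T (-1) + T 1 : Coeff) • torusMonomial (x 1) (x 2) 0 (-2) ∈ h.cone := by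
  have hq := h.isQPair_one_two
  rw [add_smul]
  exact add_mem (hq.torusMonomial_mem _ _)
    (add_mem (hq.T_smul_torusMonomial_mem _ _ _) (hq.T_smul_torusMonomial_mem _ _ _))

/-- The recurrence run forward from `X₂, X₄`, with `B = X^{(-1,2)}` and `C = X^{(1,-2)}`. The last
two memberships are lower bounds for `X_{2n+2}` and `X_{2n+4}` by single monomials, up to a power
of `q^{1/2}`. -/
lemma evenVar_forward (h : IsClusterSeq x) (n : ℕ) :
    evenVar x (n + 1) ∈ h.cone ∧
    evenVar x (n + 1) - (T (-1 - n) : Coeff) • torusMonomial (x 1) (x 2) (-n) (2 * n + 1) ∈ h.cone ∧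
    evenVar x (n + 2) - (T (-2 - n) : Coeff) • torusMonomial (x 1) (x 2) n (-(2 * n + 1))
      ∈ h.cone := by
  have hq := h.isQPair_one_two
  have hv : evenVar x 2 - torusMonomial (x 1) (x 2) (-1) 2 * evenVar x 1 =
      (T (-2) : Coeff) • torusMonomial (x 1) (x 2) (-1) (-1) +
        (T (-2) : Coeff) • torusMonomial (x 1) (x 2) 0 (-1) := by
    rw [h.evenVar_two, evenVar_one, mul_smul_comm, hq.torusMonomial_mul, T_smul_T_smul]
    simp only [smul_add]
    norm_num
    abel
  obtain ⟨h1, h2, h3, h4⟩ := mem_of_linear_recurrence h.cone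
    (B := torusMonomial (x 1) (x 2) (-1) 2)
    (C := torusMonomial (x 1) (x 2) 1 (-2)) (δ := deltaLaurent (x 1) (x 2))
    (u := fun n : ℕ => evenVar x (n + 1)) (hq.torusMonomial_mem _ _) (hq.torusMonomial_mem _ _)
    h.rest_mem (by rw [deltaLaurent]; abel)
    (by rw [hq.torusMonomial_mul]; norm_num [T_zero_smul, IsQPair.torusMonomial_zero_zero])
    (fun n => by
      rw [h.deltaLaurent_mul_evenVar]
      push_cast
      ring_nf
      abel)
    (by
      simp only [Nat.cast_zero, zero_add]
      rw [evenVar_one]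
      exact hq.T_smul_torusMonomial_mem _ _ _)
    (by
      simp only [Nat.cast_zero, zero_add, Nat.cast_one, one_add_one_eq_two]
      rw [hv]
      exact add_mem (hq.T_smul_torusMonomial_mem _ _ _) (hq.T_smul_torusMonomial_mem _ _ _)) n
  simp only [Nat.cast_zero, zero_add, Nat.cast_one, one_add_one_eq_two, hv, Nat.cast_add] at *
  refine ⟨h1, ?_, ?_⟩
  · convert h3 using 2
    rw [hq.torusMonomial_pow, evenVar_one, mul_smul_comm, hq.torusMonomial_mul, T_smul_T_smul]
    congr 2 <;> ring_nf
  · have h5 := add_mem (add_mem (mul_mem (hq.torusMonomial_mem (-1) 2) h1) h4)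
      (mul_mem (pow_mem (hq.torusMonomial_mem 1 (-2)) n)
        (hq.T_smul_torusMonomial_mem (-2) (-1) (-1)))
    convert h5 using 1
    have h6 : torusMonomial (x 1) (x 2) 1 (-2) ^ n *
        (T (-2) : Coeff) • torusMonomial (x 1) (x 2) 0 (-1) =
          (T (-2 - n) : Coeff) • torusMonomial (x 1) (x 2) n (-(2 * n + 1)) := by
      rw [hq.torusMonomial_pow, mul_smul_comm, hq.torusMonomial_mul, T_smul_T_smul]
      congr 2 <;> ring_nf
    rw [mul_add, h6, show (n : ℤ) + 1 + 1 = n + 2 by ring]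
    abel

/-- The recurrence run backward from `X₂, X₀`, with `B = X^{(1,-2)}` and `C = X^{(-1,2)}`. The last
two memberships are lower bounds for `X_{2-2n}` and `X_{-2n}` by single monomials, up to a power
of `q^{1/2}`. -/
lemma evenVar_backward (h : IsClusterSeq x) (n : ℕ) :
    evenVar x (1 - n) ∈ h.cone ∧
    evenVar x (1 - n) - (T (n - 1) : Coeff) • torusMonomial (x 1) (x 2) n (1 - 2 * n) ∈ h.cone ∧
    evenVar x (-n) - (T n : Coeff) • torusMonomial (x 1) (x 2) (-n) (2 * n - 1) ∈ h.cone := by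
  have hq := h.isQPair_one_two
  have hv : evenVar x 0 - torusMonomial (x 1) (x 2) 1 (-2) * evenVar x 1 =
      torusMonomial (x 1) (x 2) 0 (-1) := by
    rw [h.evenVar_zero, evenVar_one, mul_smul_comm, hq.torusMonomial_mul, T_smul_T_smul]
    norm_num [T_zero_smul]
  obtain ⟨h1, h2, h3, h4⟩ := mem_of_linear_recurrence h.cone
    (B := torusMonomial (x 1) (x 2) 1 (-2))
    (C := torusMonomial (x 1) (x 2) (-1) 2) (δ := deltaLaurent (x 1) (x 2))
    (u := fun n : ℕ => evenVar x (1 - n)) (hq.torusMonomial_mem _ _) (hq.torusMonomial_mem _ _)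
    h.rest_mem (by rw [deltaLaurent]; abel)
    (by rw [hq.torusMonomial_mul]; norm_num [T_zero_smul, IsQPair.torusMonomial_zero_zero])
    (fun n => by
      rw [h.deltaLaurent_mul_evenVar]
      push_cast
      ring_nf
      abel)
    (by
      simp only [Nat.cast_zero, sub_zero]
      rw [evenVar_one]
      exact hq.T_smul_torusMonomial_mem _ _ _)
    (by
      simp only [Nat.cast_zero, sub_zero, Nat.cast_one, sub_self]
      rw [hv]
      exact hq.torusMonomial_mem _ _) n
  simp only [Nat.cast_zero, sub_zero, Nat.cast_one, sub_self, hv, Nat.cast_add] at *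
  refine ⟨h1, ?_, ?_⟩
  · convert h3 using 2
    rw [hq.torusMonomial_pow, evenVar_one, mul_smul_comm, hq.torusMonomial_mul, T_smul_T_smul]
    congr 2 <;> ring_nf
  · convert add_mem (mul_mem (hq.torusMonomial_mem 1 (-2)) h1) h4 using 1
    rw [hq.torusMonomial_pow, hq.torusMonomial_mul, show (1 : ℤ) - (n + 1) = -n by ring]
    ring_nf
    abel

lemma evenVar_mem (h : IsClusterSeq x) (n : ℤ) : evenVar x n ∈ h.cone := by
  rcases le_or_gt 1 n with hn | hn
  · obtain ⟨m, rfl⟩ : ∃ m : ℕ, n = m + 1 := ⟨(n - 1).toNat, by omega⟩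
    exact (h.evenVar_forward m).1
  · obtain ⟨m, rfl⟩ : ∃ m : ℕ, n = 1 - m := ⟨(1 - n).toNat, by omega⟩
    exact (h.evenVar_backward m).1

/-- If `X_{2n}` and `X_{2n+2}` dominate monomials that are inverse to each other, then `1` can be
subtracted from their product without losing positivity. -/
lemma odd_mem (h : IsClusterSeq x) {n k l a b : ℤ}
    (h1 : evenVar x n - (T k : Coeff) • torusMonomial (x 1) (x 2) a b ∈ h.cone)
    (h2 : evenVar x (n + 1) - (T l : Coeff) • torusMonomial (x 1) (x 2) (-a) (-b) ∈ h.cone)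
    (hkl : 2 * n + 1 + k + l = 0) : x (2 * n + 1) ∈ h.cone := by
  have hq := h.isQPair_one_two
  have hx : x (2 * n + 1) = (T (-1) : Coeff) • (x (2 * n) * x (2 * n + 2) - 1) := by
    have h1 := h.exchange_odd (2 * n + 1) (by grind)
    rw [add_sub_cancel_right, show 2 * n + 1 + 1 = 2 * n + 2 by ring] at h1
    rw [h1, add_sub_cancel_right, T_smul_T_smul, neg_add_cancel, T_zero_smul]
  have hprod : x (2 * n) * x (2 * n + 2) =
      (T (2 * n + 1) : Coeff) • evenVar x n * evenVar x (n + 1) := by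
    rw [show 2 * n + 2 = 2 * (n + 1) by ring, eq_smul_evenVar x, eq_smul_evenVar x, smul_mul_assoc,
      mul_smul_comm, T_smul_T_smul, smul_mul_assoc]
    congr 2
    ring
  rw [hx, hprod]
  refine hq.T_smul_mem _ (mul_sub_one_mem _
    (hq.T_smul_torusMonomial_mem (2 * n + 1 + k) a b) (h.evenVar_mem _) ?_ h2 ?_)
  · rw [← T_smul_T_smul (2 * n + 1) k, ← smul_sub]
    exact hq.T_smul_mem _ h1
  · rw [smul_mul_assoc, mul_smul_comm, T_smul_T_smul, hkl, T_zero_smul, hq.torusMonomial_mul,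
      show a * -b - b * -a = 0 by ring, T_zero_smul, add_neg_cancel, add_neg_cancel,
      IsQPair.torusMonomial_zero_zero]

/-- Positivity of the cluster variables in the cluster `{X₁, X₂}`. -/
theorem mem_cone (h : IsClusterSeq x) (k : ℤ) : x k ∈ h.cone := by
  have hq := h.isQPair_one_two
  obtain ⟨n, rfl | rfl⟩ := Int.even_or_odd' k
  · rw [eq_smul_evenVar x]
    exact hq.T_smul_mem _ (h.evenVar_mem n)
  rcases le_or_gt n 0 with hn | hn
  · obtain ⟨m, rfl⟩ : ∃ m : ℕ, n = -m := ⟨(-n).toNat, by omega⟩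
    obtain ⟨-, h1, h2⟩ := h.evenVar_backward m
    refine h.odd_mem h2 (l := m - 1) ?_ (by ring)
    rwa [neg_neg, neg_sub, neg_add_eq_sub]
  · obtain ⟨m, rfl⟩ : ∃ m : ℕ, n = m + 1 := ⟨(n - 1).toNat, by omega⟩
    obtain ⟨-, h1, h2⟩ := h.evenVar_forward m
    refine h.odd_mem h1 (l := -2 - m) ?_ (by ring)
    rwa [neg_neg, add_assoc, one_add_one_eq_two]

lemma deltaLaurent_mem (h : IsClusterSeq x) : deltaLaurent (x 1) (x 2) ∈ h.cone := by
  have hq := h.isQPair_one_two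
  have h1 := add_mem (add_mem h.rest_mem (hq.torusMonomial_mem (-1) 2))
    (hq.torusMonomial_mem 1 (-2))
  convert h1 using 1
  rw [deltaLaurent]
  abel

end IsClusterSeq

/-! ### Chebyshev polynomials -/

/-- Evaluation of integral polynomials at an element of a ring. -/
noncomputable def intEval {R : Type*} [Ring R] (d : R) : Polynomial ℤ →+* R :=
  (Polynomial.aeval d : Polynomial ℤ →ₐ[ℤ] R).toRingHom

lemma intEval_X {R : Type*} [Ring R] (d : R) : intEval d Polynomial.X = d := Polynomial.aeval_X d

open MulOpposite in
lemma op_intEval {R : Type*} [Ring R] (d : R) (p : Polynomial ℤ) :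
    op (intEval d p) = intEval (op d) p := by
  induction p using Polynomial.induction_on with
  | C a => simp
  | add p q hp hq => simp [hp, hq]
  | monomial n a _ => simpa [intEval_X] using (Int.cast_commute a (op d ^ (n + 1))).symm.eq

lemma intEval_mem {R : Type*} [Ring R] (S : Subring R) {d : R} (hd : d ∈ S) (p : Polynomial ℤ) :
    intEval d p ∈ S := by
  induction p using Polynomial.induction_on with
  | C a => simp
  | add p q hp hq => simpa using add_mem hp hq
  | monomial n a _ => simpa [intEval_X] using mul_mem (intCast_mem S a) (pow_mem hd (n + 1))

namespace IsClusterSeq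

variable {x : ℤ → D}

/-- The polynomials `F_n` act on the even cluster variables like `t ^ n + t ^ (-n)`. -/
lemma intEval_chebyshevF_mul_evenVar (h : IsClusterSeq x) (n : ℕ) (k : ℤ) :
    intEval (deltaLaurent (x 1) (x 2)) (chebyshevF (n + 1)) * evenVar x k =
      evenVar x (k - (n + 1)) + evenVar x (k + (n + 1)) := by
  induction n using Nat.strong_induction_on generalizing k with
  | _ n ih =>
    match n with
    | 0 => simp [chebyshevF, intEval_X, h.deltaLaurent_mul_evenVar]
    | 1 =>
      have h1 : chebyshevF 2 = Polynomial.X * Polynomial.X - 2 := by rw [chebyshevF, sq]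
      simp only [Nat.reduceAdd, h1, map_sub, map_mul, intEval_X, sub_mul, mul_assoc,
        h.deltaLaurent_mul_evenVar, mul_add, map_ofNat, two_mul]
      push_cast
      ring_nf
      abel
    | n + 2 =>
      have h1 := ih (n + 1) (by omega)
      have h2 := ih n (by omega)
      simp only [chebyshevF, map_sub, map_mul, intEval_X, sub_mul, mul_assoc,
        h.deltaLaurent_mul_evenVar, mul_add, h1, h2]
      push_cast
      ring_nf
      abel

/-- Dividing `F_n(δ) X₂` by the monomial `X₂` turns positivity of the even cluster variables into
positivity of `F_n(δ)`. -/
theorem intEval_chebyshevF_mem (h : IsClusterSeq x) (n : ℕ) :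
    intEval (deltaLaurent (x 1) (x 2)) (chebyshevF n) ∈ h.cone := by
  rcases n with _ | n
  · simp [chebyshevF]
  have h1 : intEval (deltaLaurent (x 1) (x 2)) (chebyshevF (n + 1)) =
      (T 1 : Coeff) • ((evenVar x (1 - (n + 1)) + evenVar x (1 + (n + 1))) * (x 2)⁻¹) := by
    have h2 : evenVar x 1 = (T (-1) : Coeff) • x 2 := rfl
    rw [← h.intEval_chebyshevF_mul_evenVar, h2, mul_smul_comm, smul_mul_assoc, T_smul_T_smul,
      mul_inv_cancel_right₀ (h.ne_zero 2), add_neg_cancel, T_zero_smul]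
  rw [h1]
  exact h.isQPair_one_two.T_smul_mem _
    (mul_mem (add_mem (h.evenVar_mem _) (h.evenVar_mem _)) h.isQPair_one_two.inv_right_mem)

end IsClusterSeq

lemma chebyshevS_add_two (n : ℕ) : chebyshevS (n + 2) = chebyshevS n + chebyshevF (n + 2) := by
  induction n using Nat.strong_induction_on with
  | _ n ih =>
    match n with
    | 0 => simp only [chebyshevS, chebyshevF]; ring
    | 1 => simp only [chebyshevS, chebyshevF]; ring
    | n + 2 =>
      have h1 := ih (n + 1) (by omega)
      have h2 := ih n (by omega)
      have hS : chebyshevS (n + 4) = chebyshevS (n + 3) * Polynomial.X - chebyshevS (n + 2) := rfl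
      have hF : chebyshevF (n + 4) = chebyshevF (n + 3) * Polynomial.X - chebyshevF (n + 2) := rfl
      match n with
      | 0 =>
        simp only [chebyshevS, chebyshevF]
        ring
      | m + 1 =>
        have hS' : chebyshevS (m + 3) = chebyshevS (m + 2) * Polynomial.X - chebyshevS (m + 1) :=
          rfl
        simp only [Nat.add_assoc, Nat.reduceAdd] at *
        linear_combination hS - hF + Polynomial.X * h1 - h2 - hS'

theorem IsClusterSeq.intEval_chebyshevS_mem {x : ℤ → D} (h : IsClusterSeq x) (n : ℕ) :
    intEval (deltaLaurent (x 1) (x 2)) (chebyshevS n) ∈ h.cone := by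
  induction n using Nat.twoStepInduction with
  | zero => simp [chebyshevS]
  | one => simpa [chebyshevS, intEval_X] using h.deltaLaurent_mem
  | more n ih _ =>
    rw [chebyshevS_add_two, map_add]
    exact add_mem ih (h.intEval_chebyshevF_mem _)

end

/-! ### The sequence of cluster variables -/

lemma isClusterSeq_clusterVar : IsClusterSeq clusterVar := by
  have hq : ∀ k : ℤ, QCommute (clusterVar k) (clusterVar (k + 1)) := by
    intro k
    rcases le_or_gt 1 k with hk | hk
    · obtain ⟨n, rfl⟩ : ∃ n : ℕ, k = n + 1 := ⟨(k - 1).toNat, by omega⟩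
      have := qCommute_forward n
      rw [← clusterVar_forward, ← clusterVar_forward] at this
      exact_mod_cast this
    · obtain ⟨n, rfl⟩ : ∃ n : ℕ, k = 1 - n := ⟨(1 - k).toNat, by omega⟩
      have := qCommute_backward n
      rw [← clusterVar_backward, ← clusterVar_backward] at this
      convert this using 2 <;> push_cast <;> ring
  refine ⟨fun k => (hq k).1, fun k => (hq k).2.2, fun k hk => ?_, fun k hk => ?_⟩
  · rw [clusterVar_exchange, exchange, if_pos hk]
  · rw [clusterVar_exchange, exchange, if_neg (Int.not_odd_iff_even.2 hk)]

lemma Xδ_eq_deltaLaurent : Xδ = deltaLaurent (clusterVar 1) (clusterVar 2) := rfl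

lemma evalAt_eq_intEval (x : SkewField) (p : Polynomial ℤ) : evalAt x p = intEval x p := rfl

/-! ### Laurent expansions of elements of the skew field -/

/-- A Laurent expansion in a given cluster is unique. -/
lemma IsLaurentExpansion.unique {m : ℤ} {Y : SkewField} {c d : (ℤ × ℤ) →₀ Coeff}
    (hc : IsLaurentExpansion m Y c) (hd : IsLaurentExpansion m Y d) : c = d := by
  have h0 : (c - d).sum (fun x r => r • laurentMonomial m x.1 x.2) = 0 := by
    rw [Finsupp.sum_sub_index fun x r s => sub_smul r s _, ← hc, ← hd, sub_self]
  ext1 z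
  rw [← sub_eq_zero, ← Finsupp.sub_apply]
  by_cases hz : z ∈ (c - d).support
  · exact (isClusterSeq_clusterVar.isQPair m).coeff_eq_zero_of_sum_eq_zero smul_one_injective _ _
      h0 z hz
  · exact Finsupp.notMem_support_iff.1 hz

/-- The elements that have a Laurent expansion with coefficients in `ℕ[q^{±1/2}]` in the cluster
`{X_m, X_{m+1}}`. -/
def natExpansions (m : ℤ) : AddSubmonoid SkewField where
  carrier := {Y | ∃ c, IsLaurentExpansion m Y c ∧ ∀ x, IsNatCoeff (c x)}
  zero_mem' := ⟨0, by simp [IsLaurentExpansion], fun x k => by simp⟩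
  add_mem' := by
    rintro _ _ ⟨c, rfl, hc⟩ ⟨d, rfl, hd⟩
    refine ⟨c + d, ?_, fun x k => ?_⟩
    · rw [IsLaurentExpansion, Finsupp.sum_add_index'
        (h := fun (x : ℤ × ℤ) (r : Coeff) => r • laurentMonomial m x.1 x.2)
        (fun x => zero_smul Coeff _) fun x r s => add_smul r s _]
    · simpa using add_nonneg (hc x k) (hd x k)

lemma T_smul_laurentMonomial_mem (m k a b : ℤ) :
    (T k : Coeff) • laurentMonomial m a b ∈ natExpansions m := by
  refine ⟨Finsupp.single (a, b) (T k), ?_, fun x l => ?_⟩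
  · rw [IsLaurentExpansion, Finsupp.sum_single_index
      (h := fun (x : ℤ × ℤ) (r : Coeff) => r • laurentMonomial m x.1 x.2) (zero_smul Coeff _)]
  · rw [Finsupp.single_apply]
    split_ifs
    · simp only [T, AddMonoidAlgebra.coeff_single, Finsupp.single_apply]
      split_ifs <;> simp
    · simp

/-- The clusters `{X_m, X_{m+1}}` with odd `m` are reached by translations. -/
lemma mem_natExpansions_of_mem_cone_shift (j : ℤ) {Y : SkewField}
    (hY : Y ∈ (isClusterSeq_clusterVar.shift j).cone) : Y ∈ natExpansions (2 * j + 1) :=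
  IsQPair.cone_induction _ (p := (· ∈ natExpansions (2 * j + 1))) (zero_mem _)
    (fun _ _ => add_mem) (fun k a b => by
      have := T_smul_laurentMonomial_mem (2 * j + 1) k a b
      rwa [laurentMonomial, add_assoc, one_add_one_eq_two] at this) hY

open MulOpposite in
/-- The clusters `{X_m, X_{m+1}}` with even `m` are reached by reflections. -/
lemma unop_mem_natExpansions_of_mem_cone_reflect (j : ℤ) {Y : SkewFieldᵐᵒᵖ}
    (hY : Y ∈ (isClusterSeq_clusterVar.reflect (j + 1)).cone) :
    unop Y ∈ natExpansions (2 * j) :=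
  IsQPair.cone_induction _ (p := (unop · ∈ natExpansions (2 * j))) (zero_mem _)
    (fun _ _ => add_mem) (fun k a b => by
      have := T_smul_laurentMonomial_mem (2 * j) k b a
      rw [laurentMonomial, mul_comm b a] at this
      beta_reduce
      rw [show 2 * (j + 1) - 1 = 2 * j + 1 by ring, show 2 * (j + 1) - 2 = 2 * j by ring]
      simpa only [torusMonomial, unop_smul, unop_mul, unop_zpow, unop_op] using this) hY

open MulOpposite in
/-- An element is positive as soon as all reparametrizations of the sequence of cluster variables
show it to be positive in the cluster at the indices `1` and `2`. -/
lemma isPositive_of_mem {Y : SkewField} (hY : Y ∈ quantumClusterAlgebra)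
    (hs : ∀ j, Y ∈ (isClusterSeq_clusterVar.shift j).cone)
    (hr : ∀ j, op Y ∈ (isClusterSeq_clusterVar.reflect (j + 1)).cone) : IsPositive Y := by
  refine ⟨hY, fun m => ?_⟩
  have hm : Y ∈ natExpansions m := by
    obtain ⟨j, rfl | rfl⟩ := Int.even_or_odd' m
    · exact unop_mem_natExpansions_of_mem_cone_reflect j (hr j)
    · exact mem_natExpansions_of_mem_cone_shift j (hs j)
  obtain ⟨c, hc, hpos⟩ := hm
  exact ⟨⟨c, hc⟩, fun d hd => hc.unique hd ▸ hpos⟩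

/-! ### Positivity of the bases -/

lemma clusterVar_mem (k : ℤ) : clusterVar k ∈ quantumClusterAlgebra :=
  Algebra.subset_adjoin ⟨k, rfl⟩

lemma laurentMonomial_natCast (m : ℤ) (a b : ℕ) : laurentMonomial m a b =
    (T (-(a * b)) : Coeff) • (clusterVar m ^ a * clusterVar (m + 1) ^ b) := by
  rw [laurentMonomial, zpow_natCast, zpow_natCast]

open MulOpposite in
lemma isPositive_of_mem_clusterMonomials {Y : SkewField} (hY : Y ∈ clusterMonomials) :
    IsPositive Y := by
  obtain ⟨m, a, b, rfl⟩ := hY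
  rw [laurentMonomial_natCast]
  have hs : ∀ j k, clusterVar k ∈ (isClusterSeq_clusterVar.shift j).cone := fun j k => by
    simpa using (isClusterSeq_clusterVar.shift j).mem_cone (k - 2 * j)
  have hr : ∀ j k, op (clusterVar k) ∈ (isClusterSeq_clusterVar.reflect (j + 1)).cone :=
    fun j k => by
      simpa using (isClusterSeq_clusterVar.reflect (j + 1)).mem_cone (2 * (j + 1) - k)
  refine isPositive_of_mem ?_ (fun j => ?_) (fun j => ?_)
  · exact Subalgebra.smul_mem _
      (mul_mem (pow_mem (clusterVar_mem _) _) (pow_mem (clusterVar_mem _) _)) _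
  · exact IsQPair.T_smul_mem _ _ (mul_mem (pow_mem (hs _ _) _) (pow_mem (hs _ _) _))
  · rw [op_smul, op_mul, op_pow, op_pow]
    exact IsQPair.T_smul_mem _ _ (mul_mem (pow_mem (hr _ _) _) (pow_mem (hr _ _) _))

lemma Xδ_mem : Xδ ∈ quantumClusterAlgebra := by
  rw [Xδ_eq_deltaLaurent, isClusterSeq_clusterVar.deltaLaurent_eq]
  exact sub_mem (Subalgebra.smul_mem _ (mul_mem (clusterVar_mem _) (clusterVar_mem _)) _)
    (Subalgebra.smul_mem _ (pow_mem (clusterVar_mem _) _) _)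

open MulOpposite in
/-- Since `X_δ` is given by the same Laurent polynomial in all clusters, up to reversing the
multiplication, positivity of `p(X_δ)` needs to be known only at the indices `1` and `2` of an
arbitrary cluster sequence. -/
lemma isPositive_intEval {p : Polynomial ℤ}
    (hp : ∀ {D : Type} [DivisionRing D] [Algebra Coeff D] {x : ℤ → D} (h : IsClusterSeq x),
      intEval (deltaLaurent (x 1) (x 2)) p ∈ h.cone) :
    IsPositive (intEval Xδ p) := by
  refine isPositive_of_mem ?_ (fun j => ?_) (fun j => ?_)
  · exact intEval_mem quantumClusterAlgebra.toSubring Xδ_mem p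
  · have h1 := hp (isClusterSeq_clusterVar.shift j)
    rwa [isClusterSeq_clusterVar.deltaLaurent_shift] at h1
  · have h1 := hp (isClusterSeq_clusterVar.reflect (j + 1))
    have h2 := isClusterSeq_clusterVar.deltaLaurent_reflect j
    rw [show 2 * j + 1 = 2 * (j + 1) - 1 by ring, show 2 * j = 2 * (j + 1) - 2 by ring] at h2
    rw [op_intEval]
    rwa [h2] at h1

end QCluster14

theorem mainTheorem3 :
    (∀ Y ∈ QCluster14.basisB, QCluster14.IsPositive Y) ∧
    (∀ Y ∈ QCluster14.basisS, QCluster14.IsPositive Y) ∧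
    (∀ Y ∈ QCluster14.basisD, QCluster14.IsPositive Y) := by
  refine ⟨?_, ?_, ?_⟩
  · rintro Y (hY | ⟨n, rfl⟩)
    · exact QCluster14.isPositive_of_mem_clusterMonomials hY
    · simp only [QCluster14.evalAt_eq_intEval]
      exact QCluster14.isPositive_intEval fun h => h.intEval_chebyshevF_mem n
  · rintro Y (hY | ⟨n, rfl⟩)
    · exact QCluster14.isPositive_of_mem_clusterMonomials hY
    · simp only [QCluster14.evalAt_eq_intEval]
      exact QCluster14.isPositive_intEval fun h => h.intEval_chebyshevS_mem n
  · rintro Y (hY | ⟨n, rfl⟩)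
    · exact QCluster14.isPositive_of_mem_clusterMonomials hY
    · have h1 : QCluster14.IsPositive
          (QCluster14.intEval QCluster14.Xδ (Polynomial.X ^ n)) :=
        QCluster14.isPositive_intEval fun h => by
          simpa [QCluster14.intEval_X] using pow_mem h.deltaLaurent_mem n
      simpa [QCluster14.intEval_X] using h1
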